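/- Let $\kappa>0$ (wave number) and $R>0$. Axisymmetric functions on the ball of radius $R$ are written $f(\rho,t)$ with $\rho\in[0,R]$, $t=\cos\theta\in[-1,1]$; $\|f\|_\infty$ is the supremum over $[0,R]\times[-1,1]$. Let $P_n$ be the Legendre polynomials, $f_n(\rho)=\frac{2n+1}{2}\int_{-1}^{1}f(\rho,t)P_n(t)\,dt$ the Legendre coefficients of $f$, and $f^F(\rho,t)=\sum_{n=0}^{F}f_n(\rho)P_n(t)$. Let $j_n$ and $h_n^{(1)}=j_n+iy_n$ be the spherical Bessel and Hankel functions. For a bounded measurable contrast $m$ (complex-valued, $m=1-n^2$ with refractive index $n$, vanishing outside the ball of radius $R$) and bounded measurable $w$ put $$(K_nw)(\tilde\rho)=-(2n+1)\kappa^3\int_0^R h_n^{(1)}(\kappa\max(\tilde\rho,\rho))\,j_n(\kappa\min(\tilde\rho,\rho))\Big(\int_0^\pi w(\rho,\cos\theta)\,m(\rho,\cos\theta)\,P_n(\cos\theta)\sin\theta\,d\theta\Big)\rho^2\,d\rho,$$ $$(K^Fw)(\rho,t)=\sum_{n=0}^{F}(K_nw)(\rho)P_n(t).$$ Let $u^i$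 be a bounded measurable incident field, and let $u$ be a bounded measurable solution of the axisymmetric Lippmann--Schwinger equation $$u_n(\rho)=u^i_n(\rho)+\tfrac{i}{2}(K_nu)(\rho),\qquad 0\le\rho\le R,\ n=0,1,2,\dots$$ For every $F$ let $v^F$ be a bounded measurable solution of the truncated equation $v^F=(u^i)^F+\frac i2K^Fv^F$ on $[0,R]\times[-1,1]$. Assume that there is a constant $B$ such that, for all $F$, the operator $I-\frac i2K^F$ is invertible on the bounded measurable functions on $[0,R]\times[-1,1]$ with $\|(I-\frac i2K^F)^{-1}\|_\infty\le B$. Let $k\ge0$ be an integer and $\alpha>0$ real, with $\alpha<1$ if $k\le1$, and suppose that, uniformly in $\rho\in[0,R]$, $$|m_l(\rho)|=O\big(l^{-(k+\alpha)}\big),\qquad |u_s(\rho)|=O\big(s^{-(k+2+\alpha)}\big)\qquad(l,s\ge1).$$ Then, as $F\to\infty$, $$\varepsilon_F:=\|u^F-v^F\|_\infty=\begin{cases}O\big(F^{-(k+2.5+\alpha+\min(1.5,\,k-2+\alpha))}\big)&\text{if }k\ge3,\\ O\big(\log F\cdot F^{-(4.5+\alpha+\min(1,\,.5+\alpha))}\big)&\text{if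 }k=2,\\ O\big(F^{-(3+2\alpha)}\big)&\text{if }k=1,\\ O\big(F^{-(1+2\alpha)}\big)&\text{if }k=0.\end{cases}$$ -/

import Mathlib

open Filter Set MeasureTheory
open scoped ENNReal NNReal

noncomputable section

namespace AxiLS

/-- The Legendre polynomial `P_n`, by Rodrigues' formula
`P_n(t) = (2 ^ n n!)⁻¹ (d/dt)^n (t ^ 2 - 1) ^ n`. -/
def legendrePoly (n : ℕ) : Polynomial ℝ :=
  Polynomial.C ((1 : ℝ) / (2 ^ n * (n.factorial : ℝ))) *
    (Polynomial.derivative^[n] ((Polynomial.X ^ 2 - 1) ^ n))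

/-- The value `P_n(t)`. -/
def P (n : ℕ) (t : ℝ) : ℝ := (legendrePoly n).eval t

/-- The spherical Bessel function of the first kind,
`j_n(x) = x ^ n / (1·3·5⋯(2n+1)) · ∑_p (-x²/2) ^ p / (p! (2n+3)(2n+5)⋯(2n+2p+1))`. -/
def sphJ (n : ℕ) (x : ℝ) : ℝ :=
  x ^ n / (∏ q ∈ Finset.range (n + 1), (2 * (q : ℝ) + 1)) *
    ∑' p : ℕ, (-(x ^ 2 / 2)) ^ p /
      ((p.factorial : ℝ) * ∏ q ∈ Finset.range p, (2 * (n : ℝ) + 2 * (q : ℝ) + 3))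

/-- The spherical Bessel function of the second kind,
`y_n(x) = -(1·3·5⋯(2n-1)) / x ^ (n+1) · ∑_p (-x²/2) ^ p / (p! (1-2n)(3-2n)⋯(2p-1-2n))`,
for `x > 0`. -/
def sphY (n : ℕ) (x : ℝ) : ℝ :=
  -((∏ q ∈ Finset.range n, (2 * (q : ℝ) + 1)) / x ^ (n + 1)) *
    ∑' p : ℕ, (-(x ^ 2 / 2)) ^ p /
      ((p.factorial : ℝ) * ∏ q ∈ Finset.range p, (2 * (q : ℝ) + 1 - 2 * (n : ℝ)))

/-- The spherical Hankel function of the first kind, `h_n^{(1)} = j_n + i y_n`. -/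
def sphH (n : ℕ) (x : ℝ) : ℂ := (sphJ n x : ℂ) + Complex.I * (sphY n x : ℂ)

/-!
An axisymmetric function on the ball of radius `R` is written `f ρ t`, where `ρ ∈ [0, R]` is
the distance to the origin and `t = cos θ ∈ [-1, 1]`.
-/

/-- The supremum norm of an axisymmetric function on the ball of radius `R`; it is `⊤` exactly
if the function is unbounded there. -/
def supNorm (R : ℝ) (f : ℝ → ℝ → ℂ) : ℝ≥0∞ :=
  ⨆ ρ ∈ Icc (0 : ℝ) R, ⨆ t ∈ Icc (-1 : ℝ) 1, ‖f ρ t‖ₑ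

/-- Measurable axisymmetric functions that are bounded on the ball of radius `R`. -/
def BddMeas (R : ℝ) (f : ℝ → ℝ → ℂ) : Prop :=
  Measurable (Function.uncurry f) ∧ supNorm R f < ⊤

/-- The `n`-th Legendre coefficient of `f` at radius `ρ`:
`f_n(ρ) = (2n+1)/2 · ∫_{-1}^1 f(ρ, t) P_n(t) dt`. -/
def coeff (f : ℝ → ℝ → ℂ) (n : ℕ) (ρ : ℝ) : ℂ :=
  ((2 * (n : ℂ) + 1) / 2) * ∫ t in (-1 : ℝ)..1, f ρ t * (P n t : ℂ)

/-- The truncated Legendre series `f^F(ρ, t) = ∑_{n=0}^F f_n(ρ) P_n(t)`. -/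
def trunc (F : ℕ) (f : ℝ → ℝ → ℂ) (ρ t : ℝ) : ℂ :=
  ∑ n ∈ Finset.range (F + 1), coeff f n ρ * (P n t : ℂ)

/-- The angular integral, in the variable `t = cos θ`:
`I_n(ρ) = ∫_0^π w(ρ, cos θ) m(ρ, cos θ) P_n(cos θ) sin θ dθ`. -/
def angInt (m w : ℝ → ℝ → ℂ) (n : ℕ) (ρ : ℝ) : ℂ :=
  ∫ t in (-1 : ℝ)..1, w ρ t * m ρ t * (P n t : ℂ)

/-- `(K_n w)(a) = -(2n+1) κ³ ∫_0^R h_n(κ ρ_>) j_n(κ ρ_<) I_n(ρ) ρ² dρ`, where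
`ρ_> = max(a, ρ)` and `ρ_< = min(a, ρ)`. -/
def opKn (κ R : ℝ) (m : ℝ → ℝ → ℂ) (n : ℕ) (w : ℝ → ℝ → ℂ) (a : ℝ) : ℂ :=
  -(2 * (n : ℂ) + 1) * (κ : ℂ) ^ 3 *
    ∫ ρ in (0 : ℝ)..R, sphH n (κ * max a ρ) * (sphJ n (κ * min a ρ) : ℂ) *
      angInt m w n ρ * (ρ : ℂ) ^ 2

/-- `(K^F w)(ρ, t) = ∑_{n=0}^F (K_n w)(ρ) P_n(t)`. -/
def opK (κ R : ℝ) (m : ℝ → ℝ → ℂ) (F : ℕ) (w : ℝ → ℝ → ℂ) (ρ t : ℝ) : ℂ :=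
  ∑ n ∈ Finset.range (F + 1), opKn κ R m n w ρ * (P n t : ℂ)

/-- The operator `I - (i/2) K^F`. -/
def opA (κ R : ℝ) (m : ℝ → ℝ → ℂ) (F : ℕ) (w : ℝ → ℝ → ℂ) (ρ t : ℝ) : ℂ :=
  w ρ t - Complex.I / 2 * opK κ R m F w ρ t

/-- `I - (i/2) K^F` is invertible on the bounded measurable functions with the supremum norm,
and `‖(I - (i/2) K^F)⁻¹‖ ≤ B`: it is onto, and `‖w‖ ≤ B ‖(I - (i/2) K^F) w‖` for all `w`
(which contains injectivity). -/
def InvBound (κ R : ℝ) (m : ℝ → ℝ → ℂ) (F : ℕ) (B : ℝ≥0) : Prop :=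
  (∀ g, BddMeas R g → ∃ w, BddMeas R w ∧
    ∀ ρ ∈ Icc (0 : ℝ) R, ∀ t ∈ Icc (-1 : ℝ) 1, opA κ R m F w ρ t = g ρ t) ∧
  ∀ w, BddMeas R w → supNorm R w ≤ (B : ℝ≥0∞) * supNorm R (opA κ R m F w)

/-- `u` is a bounded solution of the axisymmetric Lippmann-Schwinger equation with incident
field `ui`: `u_n = ui_n + (i/2) K_n u` on `[0, R]` for every `n`. -/
def IsExactSolution (κ R : ℝ) (m ui u : ℝ → ℝ → ℂ) : Prop :=
  BddMeas R u ∧ ∀ n : ℕ, ∀ ρ ∈ Icc (0 : ℝ) R,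
    coeff u n ρ = coeff ui n ρ + Complex.I / 2 * opKn κ R m n u ρ

/-- `v` is a bounded solution of the truncated equation `v = ui^F + (i/2) K^F v`. -/
def IsTruncatedSolution (κ R : ℝ) (m ui : ℝ → ℝ → ℂ) (F : ℕ) (v : ℝ → ℝ → ℂ) : Prop :=
  BddMeas R v ∧ ∀ ρ ∈ Icc (0 : ℝ) R, ∀ t ∈ Icc (-1 : ℝ) 1,
    v ρ t = trunc F ui ρ t + Complex.I / 2 * opK κ R m F v ρ t

/-- The Legendre coefficients of `f` decay like `O(n ^ (-s))`, uniformly on `[0, R]`. -/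
def CoeffDecay (R : ℝ) (f : ℝ → ℝ → ℂ) (s : ℝ) : Prop :=
  ∃ C : ℝ, ∀ n : ℕ, 1 ≤ n → ∀ ρ ∈ Icc (0 : ℝ) R, ‖coeff f n ρ‖ ≤ C * (n : ℝ) ^ (-s)

/-- `‖e F‖_∞ = O(r F)` as `F → ∞`. -/
def SupNormBigO (R : ℝ) (e : ℕ → ℝ → ℝ → ℂ) (r : ℕ → ℝ) : Prop :=
  ∃ C : ℝ, ∀ᶠ F in atTop, supNorm R (e F) ≤ ENNReal.ofReal (C * r F)

end AxiLS

end

/-!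
The error `u^F - v^F` solves `(I - (i/2) K^F)(u^F - v^F) = (i/2) K^F (u - u^F)`, so by the uniform
bound on the inverse it is enough to estimate `K^F` on the tail `u - u^F`. Expanding the tail in its
Legendre coefficients `u_s`, `s > F`, the angular integral of order `n ≤ F` only involves the
integrals of `P_s P_n m`, and these see `m` only through `m_l` with `s - n ≤ l ≤ s + n`, each with
weight at most `2 / s`. The radial kernel is `O((ρ_< / ρ_>) ^ n / ((2 n + 1) ρ_>))`, where `ρ_<` and
`ρ_>` are the smaller and the larger radius, so the prefactor `2 n + 1` cancels and integrating over
the radius gains a factor `1 / (n + 1)`. Summing over `s`, `l` and `n`, the indices `l > F / 2`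
contribute the order `F ^ (-(2 p + 1))`, where `p = k + α`, and the indices `l ≤ F / 2`, which
require `n > F / 2`, contribute `F ^ (-(p + 4)) ∑_{l ≤ F} l ^ (2 - p)`.
-/

namespace AxiLS

/-! ### Legendre polynomials -/

section Legendre

open Polynomial

/-- Integration of polynomials over `[-1, 1]`, as a linear functional. -/
noncomputable def polyInt : ℝ[X] →ₗ[ℝ] ℝ where
  toFun p := ∫ t in (-1 : ℝ)..1, p.eval t
  map_add' p q := by
    simp only [eval_add]
    exact intervalIntegral.integral_add (p.continuous.intervalIntegrable _ _)
      (q.continuous.intervalIntegrable _ _)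
  map_smul' c p := by simp

theorem polyInt_apply (p : ℝ[X]) : polyInt p = ∫ t in (-1 : ℝ)..1, p.eval t := rfl

theorem polyInt_derivative (p : ℝ[X]) : polyInt (derivative p) = p.eval 1 - p.eval (-1) :=
  intervalIntegral.integral_eq_sub_of_hasDerivAt (fun x _ ↦ p.hasDerivAt x)
    ((derivative p).continuous.intervalIntegrable _ _)

theorem polyInt_C_mul (c : ℝ) (p : ℝ[X]) : polyInt (C c * p) = c * polyInt p := by
  rw [← smul_eq_C_mul, map_smul, smul_eq_mul]

theorem polyInt_iterate_derivative_mul (n : ℕ) {w : ℝ[X]} (hw : (X ^ 2 - 1) ^ n ∣ w)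
    (q : ℝ[X]) :
    polyInt (derivative^[n] w * q) = (-1) ^ n * polyInt (w * derivative^[n] q) := by
  induction n generalizing w with
  | zero => simp
  | succ n ih =>
    have hw' : (X ^ 2 - 1) ^ n ∣ derivative w := by
      simpa using pow_sub_dvd_iterate_derivative_of_pow_dvd 1 hw
    have by_parts : polyInt (derivative w * derivative^[n] q) +
        polyInt (w * derivative (derivative^[n] q)) = 0 := by
      obtain ⟨r, rfl⟩ := hw
      rw [← map_add, ← derivative_mul, polyInt_derivative]
      simp
    rw [Function.iterate_succ_apply, ih hw', Function.iterate_succ_apply', pow_succ]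
    linear_combination (-1) ^ n * by_parts

theorem natDegree_legendrePoly_le (n : ℕ) : (legendrePoly n).natDegree ≤ n := by
  have h : ((X ^ 2 - 1 : ℝ[X]) ^ n).natDegree ≤ n * 2 :=
    natDegree_pow_le.trans (Nat.mul_le_mul_left _ (by compute_degree))
  refine (natDegree_C_mul_le _ _).trans ((natDegree_iterate_derivative _ _).trans ?_)
  omega

theorem degree_legendrePoly_lt {l n : ℕ} (h : l < n) : (legendrePoly l).degree < n :=
  degree_le_natDegree.trans_lt (by exact_mod_cast (natDegree_legendrePoly_le l).trans_lt h)

theorem degree_legendrePoly_mul_lt {a b n : ℕ} (h : a + b < n) :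
    (legendrePoly a * legendrePoly b).degree < n :=
  degree_le_natDegree.trans_lt <| by
    exact_mod_cast (natDegree_mul_le_of_le (natDegree_legendrePoly_le a)
      (natDegree_legendrePoly_le b)).trans_lt h

theorem polyInt_legendrePoly_mul_eq_zero (n : ℕ) {q : ℝ[X]} (hq : q.degree < n) :
    polyInt (legendrePoly n * q) = 0 := by
  rw [legendrePoly, mul_assoc, polyInt_C_mul, polyInt_iterate_derivative_mul _ dvd_rfl,
    iterate_derivative_eq_zero_of_degree_lt hq]
  simp

theorem polyInt_legendrePoly_mul_of_ne {l n : ℕ} (h : l ≠ n) :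
    polyInt (legendrePoly l * legendrePoly n) = 0 := by
  rcases lt_or_gt_of_ne h with h | h
  · rw [mul_comm, polyInt_legendrePoly_mul_eq_zero _ (degree_legendrePoly_lt h)]
  · rw [polyInt_legendrePoly_mul_eq_zero _ (degree_legendrePoly_lt h)]

theorem eval_iterate_derivative_X_sq_sub_one_pow (n : ℕ) {r : ℝ} (hr : r ^ 2 = 1) :
    (derivative^[n] ((X ^ 2 - 1 : ℝ[X]) ^ n)).eval r = n.factorial * (2 * r) ^ n := by
  have h_taylor : taylor r ((X ^ 2 - 1 : ℝ[X]) ^ n) = X ^ n * (X + C (2 * r)) ^ n := by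
    have hC : (C r : ℝ[X]) ^ 2 = 1 := by rw [← C_pow, hr, C_1]
    rw [taylor_pow, ← mul_pow]
    congr 1
    simp only [map_sub, taylor_X_pow, taylor_one, C_mul, map_ofNat, map_one]
    linear_combination hC
  have h_coeff : (X ^ n * (X + C (2 * r)) ^ n : ℝ[X]).coeff n = (2 * r) ^ n := by
    have h := coeff_X_pow_mul ((X + C (2 * r) : ℝ[X]) ^ n) n 0
    rw [zero_add] at h
    rw [h, coeff_zero_eq_eval_zero]
    simp
  rw [← factorial_smul_hasseDeriv, LinearMap.smul_apply, eval_smul, ← taylor_coeff, h_taylor,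
    h_coeff, nsmul_eq_mul]

theorem eval_legendrePoly_of_sq_eq_one (n : ℕ) {r : ℝ} (hr : r ^ 2 = 1) :
    (legendrePoly n).eval r = r ^ n := by
  have hn : (n.factorial : ℝ) ≠ 0 := by positivity
  rw [legendrePoly, eval_mul, eval_C, eval_iterate_derivative_X_sq_sub_one_pow n hr, mul_pow]
  field_simp

theorem degree_X_mul_derivative_sub_lt {A : Type*} [CommRing A] {p : A[X]} {n : ℕ}
    (hp : p.natDegree ≤ n) : (X * derivative p - C (n : A) * p).degree < (n : WithBot ℕ) := by
  rw [degree_lt_iff_coeff_zero]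
  rintro (_ | m) hm
  · simp [Nat.le_zero.mp hm]
  simp only [coeff_sub, coeff_X_mul, coeff_derivative, coeff_C_mul]
  rcases hm.eq_or_lt with rfl | h
  · push_cast
    ring
  · rw [coeff_eq_zero_of_natDegree_lt (hp.trans_lt h)]
    simp

theorem polyInt_legendrePoly_mul_self (n : ℕ) :
    polyInt (legendrePoly n * legendrePoly n) = 2 / (2 * n + 1) := by
  set p := legendrePoly n
  have h_lower : polyInt (p * (X * derivative p - C (n : ℝ) * p)) = 0 :=
    polyInt_legendrePoly_mul_eq_zero n
      (degree_X_mul_derivative_sub_lt (natDegree_legendrePoly_le n))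
  have h_deriv : derivative (X * (p * p)) =
      C (2 * n + 1 : ℝ) * (p * p) + C 2 * (p * (X * derivative p - C (n : ℝ) * p)) := by
    simp only [derivative_mul, derivative_X, C_add, C_mul, C_1, map_ofNat]
    ring
  have h_ends : polyInt (derivative (X * (p * p))) = 2 := by
    have h_neg : p.eval (-1) * p.eval (-1) = 1 := by
      rw [eval_legendrePoly_of_sq_eq_one n (by norm_num), ← mul_pow]
      norm_num
    have h_one : p.eval 1 = 1 := by simpa using eval_legendrePoly_of_sq_eq_one n (one_pow 2)
    rw [polyInt_derivative]
    simp only [eval_mul, eval_X, h_one, h_neg]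
    norm_num
  rw [h_deriv, map_add, polyInt_C_mul, polyInt_C_mul, h_lower, mul_zero, add_zero] at h_ends
  rw [eq_div_iff (by positivity)]
  linarith

theorem coeff_legendrePoly_ne_zero (n : ℕ) : (legendrePoly n).coeff n ≠ 0 := by
  intro h
  have h_degree : (legendrePoly n).degree < n := by
    rw [degree_lt_iff_coeff_zero]
    intro m hm
    rcases hm.eq_or_lt with rfl | hm
    · exact h
    · exact coeff_eq_zero_of_natDegree_lt ((natDegree_legendrePoly_le n).trans_lt hm)
  have h_norm := polyInt_legendrePoly_mul_eq_zero n h_degree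
  rw [polyInt_legendrePoly_mul_self] at h_norm
  have : (0 : ℝ) < 2 / (2 * n + 1) := by positivity
  linarith

theorem exists_degree_sub_C_mul_legendrePoly_lt {N : ℕ} {q : ℝ[X]} (hq : q.degree < (N + 1 : ℕ)) :
    ∃ c : ℝ, (q - C c * legendrePoly N).degree < N := by
  refine ⟨q.coeff N / (legendrePoly N).coeff N, ?_⟩
  rw [degree_lt_iff_coeff_zero] at hq ⊢
  intro m hm
  rw [coeff_sub, coeff_C_mul]
  rcases hm.eq_or_lt with rfl | hm
  · rw [div_mul_cancel₀ _ (coeff_legendrePoly_ne_zero N), sub_self]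
  · rw [hq m hm, coeff_eq_zero_of_natDegree_lt ((natDegree_legendrePoly_le N).trans_lt hm)]
    simp

theorem eq_sum_legendrePoly {N : ℕ} {q : ℝ[X]} (hq : q.degree < N) :
    q = ∑ l ∈ Finset.range N,
      C ((2 * (l : ℝ) + 1) / 2 * polyInt (q * legendrePoly l)) * legendrePoly l := by
  induction N generalizing q with
  | zero =>
    rw [Finset.range_zero, Finset.sum_empty, ← degree_eq_bot]
    simpa using hq
  | succ N ih =>
    obtain ⟨c, hc⟩ := exists_degree_sub_C_mul_legendrePoly_lt hq
    have h_lower : ∀ l ∈ Finset.range N,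
        polyInt ((q - C c * legendrePoly N) * legendrePoly l) = polyInt (q * legendrePoly l) := by
      intro l hl
      rw [sub_mul, map_sub, mul_assoc, polyInt_C_mul,
        polyInt_legendrePoly_mul_of_ne (Finset.mem_range.mp hl).ne', mul_zero, sub_zero]
    have h_top : (2 * (N : ℝ) + 1) / 2 * polyInt (q * legendrePoly N) = c := by
      have h := polyInt_legendrePoly_mul_eq_zero N hc
      rw [mul_comm, sub_mul, map_sub, mul_assoc, polyInt_C_mul, polyInt_legendrePoly_mul_self,
        sub_eq_zero] at h
      rw [h]
      field_simp
    rw [Finset.sum_range_succ, h_top]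
    have h_ih := ih hc
    rw [Finset.sum_congr rfl fun l hl ↦ by rw [h_lower l hl]] at h_ih
    exact sub_eq_iff_eq_add.mp h_ih

theorem X_sq_mul_derivative_X_sq_sub_one_pow (n : ℕ) :
    derivative ((X ^ 2 - 1 : ℝ[X]) ^ n) * X * X - derivative ((X ^ 2 - 1 : ℝ[X]) ^ n) =
      C (2 * n : ℝ) * ((X ^ 2 - 1) ^ n * X) := by
  rcases n with _ | n
  · simp
  · rw [derivative_pow_succ]
    simp only [derivative_sub, derivative_X_sq, derivative_one, C_mul, C_add, map_natCast,
      map_ofNat, map_one]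
    push_cast
    ring

/-- Obtained by differentiating `(X ^ 2 - 1) w' = 2 n X w`, where `w = (X ^ 2 - 1) ^ n`,
`n + 1` times. -/
theorem iterate_derivative_X_sq_sub_one_pow_ode (n : ℕ) :
    (X ^ 2 - 1) * derivative (derivative (derivative^[n] ((X ^ 2 - 1 : ℝ[X]) ^ n))) +
      2 * X * derivative (derivative^[n] ((X ^ 2 - 1) ^ n)) =
      C ((n : ℝ) * (n + 1)) * derivative^[n] ((X ^ 2 - 1) ^ n) := by
  have h := congrArg derivative^[n + 1] (X_sq_mul_derivative_X_sq_sub_one_pow n)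
  set w : ℝ[X] := (X ^ 2 - 1) ^ n
  have h_pred : n • derivative^[n - 1 + 1] w = n • derivative^[n] w := by
    rcases n with _ | n <;> simp
  have h_one : derivative^[n + 1] w = derivative (derivative^[n] w) :=
    Function.iterate_succ_apply' ..
  have h_two : derivative^[n + 1 + 1] w = derivative (derivative (derivative^[n] w)) := by
    rw [Function.iterate_succ_apply', h_one]
  simp only [iterate_derivative_sub, iterate_derivative_C_mul, iterate_derivative_mul_X,
    ← Function.iterate_succ_apply, Nat.add_sub_cancel, Nat.succ_eq_add_one, h_two, h_one,
    h_pred] at h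
  simp only [nsmul_eq_mul, C_mul, C_add, C_1, map_natCast, map_ofNat] at h ⊢
  push_cast at h
  linear_combination h

theorem legendrePoly_ode (n : ℕ) :
    (X ^ 2 - 1) * derivative (derivative (legendrePoly n)) + 2 * X * derivative (legendrePoly n) =
      C ((n : ℝ) * (n + 1)) * legendrePoly n := by
  simp only [legendrePoly, derivative_C_mul]
  linear_combination C ((1 : ℝ) / (2 ^ n * (n.factorial : ℝ))) *
    iterate_derivative_X_sq_sub_one_pow_ode n

/-- The function `n (n + 1) P_n² + (1 - t²) P_n'²`, which dominates `n (n + 1) P_n²` on `[-1, 1]`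
and is largest at the endpoints. -/
noncomputable def legendreEnergy (n : ℕ) : ℝ[X] :=
  C ((n : ℝ) * (n + 1)) * legendrePoly n ^ 2 + (1 - X ^ 2) * derivative (legendrePoly n) ^ 2

theorem derivative_legendreEnergy (n : ℕ) :
    derivative (legendreEnergy n) = 2 * X * derivative (legendrePoly n) ^ 2 := by
  simp only [legendreEnergy, derivative_add, derivative_mul, derivative_C, derivative_pow,
    derivative_sub, derivative_one, derivative_X, map_natCast]
  push_cast
  linear_combination (-2) * derivative (legendrePoly n) * legendrePoly_ode n

theorem eval_legendreEnergy_of_sq_eq_one (n : ℕ) {r : ℝ} (hr : r ^ 2 = 1) :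
    (legendreEnergy n).eval r = n * (n + 1) := by
  simp only [legendreEnergy, eval_add, eval_mul, eval_C, eval_pow, eval_sub, eval_one, eval_X, hr,
    eval_legendrePoly_of_sq_eq_one n hr, pow_right_comm r n 2]
  simp

theorem eval_legendreEnergy_le (n : ℕ) {t : ℝ} (ht : t ∈ Icc (-1 : ℝ) 1) :
    (legendreEnergy n).eval t ≤ n * (n + 1) := by
  have h_deriv (x : ℝ) : deriv (fun y ↦ (legendreEnergy n).eval y) x =
      2 * x * (derivative (legendrePoly n)).eval x ^ 2 := by
    rw [Polynomial.deriv, derivative_legendreEnergy]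
    simp
  rcases le_total 0 t with h | h
  · have h_mono : MonotoneOn (fun y ↦ (legendreEnergy n).eval y) (Icc 0 1) := by
      refine monotoneOn_of_deriv_nonneg (convex_Icc _ _) (Polynomial.continuousOn _)
        (Polynomial.differentiableOn _) fun x hx ↦ ?_
      rw [interior_Icc] at hx
      rw [h_deriv]
      have := hx.1
      positivity
    rw [← eval_legendreEnergy_of_sq_eq_one n (one_pow 2)]
    exact h_mono ⟨h, ht.2⟩ (right_mem_Icc.mpr zero_le_one) ht.2
  · have h_anti : AntitoneOn (fun y ↦ (legendreEnergy n).eval y) (Icc (-1) 0) := by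
      refine antitoneOn_of_deriv_nonpos (convex_Icc _ _) (Polynomial.continuousOn _)
        (Polynomial.differentiableOn _) fun x hx ↦ ?_
      rw [interior_Icc] at hx
      rw [h_deriv]
      exact mul_nonpos_of_nonpos_of_nonneg (by linarith [hx.2]) (sq_nonneg _)
    rw [← eval_legendreEnergy_of_sq_eq_one n (r := -1) (by norm_num)]
    exact h_anti (left_mem_Icc.mpr (by norm_num)) ⟨ht.1, h⟩ ht.1

theorem abs_P_le_one (n : ℕ) {t : ℝ} (ht : t ∈ Icc (-1 : ℝ) 1) : |P n t| ≤ 1 := by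
  rcases Nat.eq_zero_or_pos n with rfl | hn
  · simp [P, legendrePoly]
  have h_nonneg : 0 ≤ (1 - t ^ 2) * (derivative (legendrePoly n)).eval t ^ 2 :=
    mul_nonneg (by nlinarith [ht.1, ht.2]) (sq_nonneg _)
  have h_energy : (n * (n + 1) : ℝ) * P n t ^ 2 ≤ n * (n + 1) * 1 := by
    have h := eval_legendreEnergy_le n ht
    simp only [legendreEnergy, eval_add, eval_mul, eval_C, eval_pow, eval_sub, eval_one,
      eval_X] at h
    rw [P]
    linarith
  exact (sq_le_one_iff_abs_le_one _).mp (le_of_mul_le_mul_left h_energy (by positivity))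

/-- The integral of `P_a P_b P_c` over `[-1, 1]`. -/
noncomputable def tripleInt (a b c : ℕ) : ℝ :=
  polyInt (legendrePoly a * legendrePoly b * legendrePoly c)

theorem tripleInt_eq_zero {a b c : ℕ} (h : b + c < a) : tripleInt a b c = 0 := by
  rw [tripleInt, mul_assoc, polyInt_legendrePoly_mul_eq_zero _ (degree_legendrePoly_mul_lt h)]

theorem tripleInt_right_comm (a b c : ℕ) : tripleInt a b c = tripleInt a c b := by
  rw [tripleInt, mul_right_comm, tripleInt]

theorem abs_tripleInt_le_add (a b c : ℕ) :
    |tripleInt a b c| ≤ 1 / (2 * a + 1) + 1 / (2 * b + 1) := by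
  calc |tripleInt a b c|
      ≤ polyInt (C (1 / 2) * (legendrePoly a * legendrePoly a) +
          C (1 / 2) * (legendrePoly b * legendrePoly b)) := by
        rw [← Real.norm_eq_abs, tripleInt, polyInt_apply, polyInt_apply]
        refine intervalIntegral.norm_integral_le_of_norm_le (by norm_num)
          (Eventually.of_forall fun t ht ↦ ?_)
          ((Polynomial.continuous _).intervalIntegrable _ _)
        have hc : |P c t| ≤ 1 := abs_P_le_one c ⟨ht.1.le, ht.2⟩
        simp only [eval_mul, eval_add, eval_C, norm_mul, Real.norm_eq_abs]
        change |P a t| * |P b t| * |P c t| ≤ 1 / 2 * (P a t * P a t) + 1 / 2 * (P b t * P b t)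
        have h_amgm := two_mul_le_add_sq |P a t| |P b t|
        rw [sq_abs, sq_abs] at h_amgm
        linarith [mul_le_of_le_one_right (by positivity : 0 ≤ |P a t| * |P b t|) hc]
    _ = 1 / (2 * a + 1) + 1 / (2 * b + 1) := by
        rw [map_add, polyInt_C_mul, polyInt_C_mul, polyInt_legendrePoly_mul_self,
          polyInt_legendrePoly_mul_self]
        ring

theorem abs_tripleInt_le {a : ℕ} (ha : 0 < a) (b c : ℕ) : |tripleInt a b c| ≤ 2 / a := by
  have ha' : (0 : ℝ) < a := by exact_mod_cast ha
  have h_half {d : ℕ} (hd : a ≤ 2 * d) : (1 : ℝ) / (2 * a + 1) + 1 / (2 * d + 1) ≤ 2 / a := by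
    have hd' : (a : ℝ) ≤ 2 * d := by exact_mod_cast hd
    calc (1 : ℝ) / (2 * a + 1) + 1 / (2 * d + 1) ≤ 1 / a + 1 / a := by gcongr <;> linarith
      _ = 2 / a := by ring
  rcases lt_or_ge (b + c) a with h | h
  · rw [tripleInt_eq_zero h, abs_zero]
    positivity
  rcases le_total b c with hbc | hbc
  · rw [tripleInt_right_comm]
    exact (abs_tripleInt_le_add a c b).trans (h_half (by omega))
  · exact (abs_tripleInt_le_add a b c).trans (h_half (by omega))

theorem P_mul_P_eq_sum (s n : ℕ) (t : ℝ) :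
    P s t * P n t =
      ∑ l ∈ Finset.range (s + n + 1), (2 * (l : ℝ) + 1) / 2 * tripleInt s n l * P l t := by
  have h := congrArg (eval t)
    (eq_sum_legendrePoly (degree_legendrePoly_mul_lt (a := s) (b := n) (Nat.lt_succ_self _)))
  simp only [eval_mul, eval_finsetSum, eval_C] at h
  exact h

end Legendre

/-! ### Legendre expansions -/

section Expansion

open Polynomial

theorem continuous_P (n : ℕ) : Continuous (P n) := (legendrePoly n).continuous

theorem continuous_ofReal_P (n : ℕ) : Continuous fun t ↦ (P n t : ℂ) :=
  Complex.continuous_ofReal.comp (continuous_P n)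

theorem norm_P_le_one (n : ℕ) {t : ℝ} (ht : t ∈ Icc (-1 : ℝ) 1) : ‖(P n t : ℂ)‖ ≤ 1 := by
  rw [Complex.norm_real]
  exact abs_P_le_one n ht

theorem integral_P_mul_P (s n : ℕ) :
    ∫ t in (-1 : ℝ)..1, (P s t : ℂ) * (P n t : ℂ) =
      if s = n then 2 / (2 * (n : ℂ) + 1) else 0 := by
  have h (t : ℝ) : (P s t : ℂ) * (P n t : ℂ) =
      (((legendrePoly s * legendrePoly n).eval t : ℝ) : ℂ) := by
    rw [eval_mul, Complex.ofReal_mul, P, P]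
  simp_rw [h]
  rw [intervalIntegral.integral_ofReal, ← polyInt_apply]
  split_ifs with hsn
  · rw [hsn, polyInt_legendrePoly_mul_self]
    push_cast
    rfl
  · rw [polyInt_legendrePoly_mul_of_ne hsn, Complex.ofReal_zero]

section Weierstrass

variable {E : Type*} [NormedAddCommGroup E] [NormedSpace ℝ E] {a b : ℝ} {f : ℝ → E}

theorem integral_smul_eq_zero_of_forall_polynomial (hab : a ≤ b)
    (hf : IntervalIntegrable f volume a b)
    (h : ∀ q : ℝ[X], ∫ t in a..b, q.eval t • f t = 0) {g : ℝ → ℝ} (hg : Continuous g) :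
    ∫ t in a..b, g t • f t = 0 := by
  set A := ∫ t in a..b, ‖f t‖
  have hA : 0 ≤ A := intervalIntegral.integral_nonneg hab fun _ _ ↦ norm_nonneg _
  have h_approx {ε : ℝ} (hε : 0 < ε) : ‖∫ t in a..b, g t • f t‖ ≤ ε * A := by
    obtain ⟨q, hq⟩ := exists_polynomial_near_of_continuousOn a b g hg.continuousOn ε hε
    have h_sub : ∫ t in a..b, g t • f t = ∫ t in a..b, (g t - q.eval t) • f t := by
      simp_rw [sub_smul]
      rw [intervalIntegral.integral_sub (hf.continuousOn_smul hg.continuousOn)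
        (hf.continuousOn_smul q.continuous.continuousOn), h, sub_zero]
    rw [h_sub, ← intervalIntegral.integral_const_mul]
    refine intervalIntegral.norm_integral_le_of_norm_le hab
      (Eventually.of_forall fun t ht ↦ ?_) (hf.norm.const_mul _)
    rw [norm_smul, Real.norm_eq_abs, abs_sub_comm]
    gcongr
    exact (hq t ⟨ht.1.le, ht.2⟩).le
  rw [← norm_le_zero_iff]
  refine le_of_forall_pos_le_add fun δ hδ ↦ (h_approx (by positivity : 0 < δ / (A + 1))).trans ?_
  rw [zero_add, div_mul_eq_mul_div, div_le_iff₀ (by positivity)]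
  nlinarith

theorem ae_eq_zero_of_forall_polynomial [CompleteSpace E] (hab : a ≤ b)
    (hf : IntervalIntegrable f volume a b)
    (h : ∀ q : ℝ[X], ∫ t in a..b, q.eval t • f t = 0) :
    ∀ᵐ t ∂volume.restrict (Ioc a b), f t = 0 := by
  have hf' := (intervalIntegrable_iff_integrableOn_Ioc_of_le hab).mp hf
  refine ae_eq_zero_of_integral_contDiff_smul_eq_zero hf'.integrable.locallyIntegrable
    fun g hg _ ↦ ?_
  rw [← intervalIntegral.integral_of_le hab]
  exact integral_smul_eq_zero_of_forall_polynomial hab hf h hg.continuous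

end Weierstrass

/-- The Legendre coefficient `f_n` of a function `f` of the angular variable alone; `coeff f n ρ`
is by definition the coefficient of `f ρ`. -/
noncomputable def legendreCoeff (f : ℝ → ℂ) (n : ℕ) : ℂ :=
  ((2 * (n : ℂ) + 1) / 2) * ∫ t in (-1 : ℝ)..1, f t * (P n t : ℂ)

variable {f g : ℝ → ℂ}

theorem legendreCoeff_sub (hf : IntervalIntegrable f volume (-1) 1)
    (hg : IntervalIntegrable g volume (-1) 1) (n : ℕ) :
    legendreCoeff (fun t ↦ f t - g t) n = legendreCoeff f n - legendreCoeff g n := by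
  simp only [legendreCoeff, sub_mul]
  rw [intervalIntegral.integral_sub (hf.mul_continuousOn (continuous_ofReal_P n).continuousOn)
    (hg.mul_continuousOn (continuous_ofReal_P n).continuousOn), mul_sub]

theorem integral_mul_P_eq (f : ℝ → ℂ) (n : ℕ) :
    ∫ t in (-1 : ℝ)..1, f t * (P n t : ℂ) = 2 / (2 * (n : ℂ) + 1) * legendreCoeff f n := by
  have : (2 * (n : ℂ) + 1) ≠ 0 := by exact_mod_cast (2 * n).succ_ne_zero
  rw [legendreCoeff]
  field_simp

theorem integral_polynomial_smul_eq_zero (hf : IntervalIntegrable f volume (-1) 1)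
    (h : ∀ n, legendreCoeff f n = 0) (q : ℝ[X]) : ∫ t in (-1 : ℝ)..1, q.eval t • f t = 0 := by
  obtain ⟨N, c, hq⟩ : ∃ (N : ℕ) (c : ℕ → ℝ),
      q = ∑ l ∈ Finset.range N, C (c l) * legendrePoly l :=
    ⟨_, _, eq_sum_legendrePoly (degree_le_natDegree.trans_lt
      (by exact_mod_cast q.natDegree.lt_succ_self))⟩
  have h_expand (t : ℝ) : q.eval t • f t =
      ∑ l ∈ Finset.range N, (c l : ℂ) * (f t * (P l t : ℂ)) := by
    rw [hq]
    simp only [eval_finsetSum, eval_mul, eval_C, Complex.real_smul, Complex.ofReal_sum,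
      Complex.ofReal_mul, Finset.sum_mul, P]
    exact Finset.sum_congr rfl fun l _ ↦ by ring
  simp_rw [h_expand]
  rw [intervalIntegral.integral_finsetSum fun l _ ↦
    (hf.mul_continuousOn (continuous_ofReal_P l).continuousOn).const_mul _]
  simp [intervalIntegral.integral_const_mul, integral_mul_P_eq, h]

theorem ae_eq_of_legendreCoeff_eq (hf : IntervalIntegrable f volume (-1) 1)
    (hg : IntervalIntegrable g volume (-1) 1) (h : ∀ n, legendreCoeff f n = legendreCoeff g n) :
    ∀ᵐ t ∂volume.restrict (Ioc (-1 : ℝ) 1), f t = g t := by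
  have h_sub := ae_eq_zero_of_forall_polynomial (by norm_num) (hf.sub hg)
    (integral_polynomial_smul_eq_zero (hf.sub hg) fun n ↦ by
      rw [legendreCoeff_sub hf hg, h, sub_self])
  filter_upwards [h_sub] with t ht
  exact sub_eq_zero.mp ht

theorem norm_mul_P_le (c : ℂ) (s : ℕ) {t : ℝ} (ht : t ∈ Icc (-1 : ℝ) 1) :
    ‖c * (P s t : ℂ)‖ ≤ ‖c‖ := by
  rw [norm_mul]
  exact mul_le_of_le_one_right (norm_nonneg _) (norm_P_le_one s ht)

theorem hasSum_integral_legendreSeries_mul {c : ℕ → ℂ} (hc : Summable fun s ↦ ‖c s‖)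
    {h : ℝ → ℂ} (hh : IntervalIntegrable h volume (-1) 1) :
    HasSum (fun s ↦ c s * ∫ t in (-1 : ℝ)..1, (P s t : ℂ) * h t)
      (∫ t in (-1 : ℝ)..1, (∑' s, c s * (P s t : ℂ)) * h t) := by
  have h_mem {t : ℝ} (ht : t ∈ uIoc (-1 : ℝ) 1) : t ∈ Icc (-1 : ℝ) 1 := by
    rw [uIoc_of_le (by norm_num)] at ht
    exact Ioc_subset_Icc_self ht
  simp_rw [← intervalIntegral.integral_const_mul, ← mul_assoc]
  refine intervalIntegral.hasSum_integral_of_dominated_convergence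
    (fun s t ↦ ‖c s‖ * ‖h t‖) (fun s ↦ ?_) (fun s ↦ Eventually.of_forall fun t ht ↦ ?_)
    (Eventually.of_forall fun t _ ↦ hc.mul_right _) ?_ (Eventually.of_forall fun t ht ↦ ?_)
  · exact (continuous_const.mul (continuous_ofReal_P s)).aestronglyMeasurable.mul
      hh.def'.aestronglyMeasurable
  · rw [norm_mul]
    gcongr
    exact norm_mul_P_le _ _ (h_mem ht)
  · simp_rw [tsum_mul_right]
    exact hh.norm.const_mul _
  · exact (Summable.of_norm_bounded hc fun s ↦ norm_mul_P_le _ _ (h_mem ht)).hasSum.mul_right _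

theorem legendreCoeff_legendreSeries {c : ℕ → ℂ} (hc : Summable fun s ↦ ‖c s‖) (n : ℕ) :
    legendreCoeff (fun t ↦ ∑' s, c s * (P s t : ℂ)) n = c n := by
  have h := hasSum_integral_legendreSeries_mul hc
    ((continuous_ofReal_P n).intervalIntegrable (-1) 1)
  simp_rw [integral_P_mul_P] at h
  have h_eq := h.unique (hasSum_single n fun s hs ↦ by rw [if_neg hs, mul_zero])
  have : (2 * (n : ℂ) + 1) ≠ 0 := by exact_mod_cast (2 * n).succ_ne_zero
  rw [legendreCoeff, h_eq, if_pos rfl]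
  field_simp

theorem intervalIntegrable_legendreSeries {c : ℕ → ℂ} (hc : Summable fun s ↦ ‖c s‖) :
    IntervalIntegrable (fun t ↦ ∑' s, c s * (P s t : ℂ)) volume (-1) 1 := by
  refine ContinuousOn.intervalIntegrable ?_
  rw [uIcc_of_le (by norm_num)]
  exact continuousOn_tsum (fun s ↦ (continuous_const.mul (continuous_ofReal_P s)).continuousOn)
    hc fun s t ht ↦ norm_mul_P_le _ _ ht

theorem hasSum_integral_mul_of_summable_legendreCoeff (hf : IntervalIntegrable f volume (-1) 1)
    (hc : Summable fun s ↦ ‖legendreCoeff f s‖) {h : ℝ → ℂ}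
    (hh : IntervalIntegrable h volume (-1) 1) :
    HasSum (fun s ↦ legendreCoeff f s * ∫ t in (-1 : ℝ)..1, (P s t : ℂ) * h t)
      (∫ t in (-1 : ℝ)..1, f t * h t) := by
  have h_series : ∀ᵐ t ∂volume.restrict (Ioc (-1 : ℝ) 1),
      f t = ∑' s, legendreCoeff f s * (P s t : ℂ) :=
    ae_eq_of_legendreCoeff_eq hf (intervalIntegrable_legendreSeries hc) fun n ↦
      (legendreCoeff_legendreSeries hc n).symm
  have h_integral : ∫ t in (-1 : ℝ)..1, f t * h t =
      ∫ t in (-1 : ℝ)..1, (∑' s, legendreCoeff f s * (P s t : ℂ)) * h t := by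
    rw [intervalIntegral.integral_of_le (by norm_num),
      intervalIntegral.integral_of_le (by norm_num)]
    refine integral_congr_ae ?_
    filter_upwards [h_series] with t ht
    rw [← ht]
  rw [h_integral]
  exact hasSum_integral_legendreSeries_mul hc hh

theorem integral_P_mul_mul_P (hf : IntervalIntegrable f volume (-1) 1) (s n : ℕ) :
    ∫ t in (-1 : ℝ)..1, (P s t : ℂ) * (f t * (P n t : ℂ)) =
      ∑ l ∈ Finset.range (s + n + 1), (tripleInt s n l : ℂ) * legendreCoeff f l := by
  have h_linearize (t : ℝ) : (P s t : ℂ) * (f t * (P n t : ℂ)) =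
      ∑ l ∈ Finset.range (s + n + 1),
        ((tripleInt s n l : ℂ) * ((2 * (l : ℂ) + 1) / 2)) * (f t * (P l t : ℂ)) := by
    have h := congrArg Complex.ofReal (P_mul_P_eq_sum s n t)
    push_cast at h
    rw [mul_left_comm, h, Finset.mul_sum]
    exact Finset.sum_congr rfl fun l _ ↦ by ring
  simp_rw [h_linearize]
  rw [intervalIntegral.integral_finsetSum fun l _ ↦
    (hf.mul_continuousOn (continuous_ofReal_P l).continuousOn).const_mul _]
  simp only [intervalIntegral.integral_const_mul, legendreCoeff, mul_assoc]

theorem norm_integral_P_mul_mul_P_le (hf : IntervalIntegrable f volume (-1) 1) {b : ℕ → ℝ}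
    (hb : ∀ l, 1 ≤ l → ‖legendreCoeff f l‖ ≤ b l) {s n : ℕ} (hn : n < s) :
    ‖∫ t in (-1 : ℝ)..1, (P s t : ℂ) * (f t * (P n t : ℂ))‖ ≤
      2 / s * ∑ l ∈ Finset.Icc (s - n) (s + n), b l := by
  have h_vanish : ∑ l ∈ Finset.range (s + n + 1), (tripleInt s n l : ℂ) * legendreCoeff f l =
      ∑ l ∈ Finset.Icc (s - n) (s + n), (tripleInt s n l : ℂ) * legendreCoeff f l := by
    symm
    refine Finset.sum_subset (fun l hl ↦ ?_) fun l hl hl' ↦ ?_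
    · simp only [Finset.mem_Icc, Finset.mem_range] at hl ⊢
      omega
    · simp only [Finset.mem_Icc, Finset.mem_range] at hl hl'
      rw [tripleInt_eq_zero (by omega), Complex.ofReal_zero, zero_mul]
  rw [integral_P_mul_mul_P hf, h_vanish, Finset.mul_sum]
  refine (norm_sum_le _ _).trans (Finset.sum_le_sum fun l hl ↦ ?_)
  rw [Finset.mem_Icc] at hl
  rw [norm_mul, Complex.norm_real, Real.norm_eq_abs]
  exact mul_le_mul (abs_tripleInt_le (by omega) _ _) (hb l (by omega)) (norm_nonneg _)
    (by positivity)

end Expansion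

/-! ### Spherical Bessel and Hankel functions -/

section Bessel

theorem hasSum_pow_div_factorial (x : ℝ) :
    HasSum (fun p : ℕ ↦ x ^ p / (p.factorial : ℝ)) (Real.exp x) := by
  rw [Real.exp_eq_exp_ℝ]
  exact NormedSpace.expSeries_div_hasSum_exp x

section Series

variable {d : ℕ → ℝ}

theorem norm_besselTerm_le (x : ℝ) (hd : ∀ p, 1 ≤ |d p|) (p : ℕ) :
    ‖(-(x ^ 2 / 2)) ^ p / ((p.factorial : ℝ) * d p)‖ ≤ (x ^ 2 / 2) ^ p / (p.factorial : ℝ) := by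
  have hp : (0 : ℝ) < p.factorial := by positivity
  rw [norm_div, norm_mul, norm_pow, norm_neg, Real.norm_of_nonneg (by positivity),
    Real.norm_of_nonneg hp.le, Real.norm_eq_abs]
  gcongr
  exact le_mul_of_one_le_right hp.le (hd p)

theorem abs_besselSeries_le (x : ℝ) (hd : ∀ p, 1 ≤ |d p|) :
    |∑' p : ℕ, (-(x ^ 2 / 2)) ^ p / ((p.factorial : ℝ) * d p)| ≤ Real.exp (x ^ 2 / 2) :=
  tsum_of_norm_bounded (hasSum_pow_div_factorial _) (norm_besselTerm_le x hd)

theorem measurable_besselSeries (hd : ∀ p, 1 ≤ |d p|) :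
    Measurable fun x : ℝ ↦ ∑' p : ℕ, (-(x ^ 2 / 2)) ^ p / ((p.factorial : ℝ) * d p) := by
  refine measurable_of_tendsto_metrizable (f := fun (N : ℕ) (x : ℝ) ↦
    ∑ p ∈ Finset.range N, (-(x ^ 2 / 2)) ^ p / ((p.factorial : ℝ) * d p)) (fun N ↦ by fun_prop) ?_
  exact tendsto_pi_nhds.mpr fun x ↦ (Summable.of_norm_bounded
    (hasSum_pow_div_factorial _).summable (norm_besselTerm_le x hd)).hasSum.tendsto_sum_nat

end Series

theorem one_le_abs_prod_sphJ (n p : ℕ) :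
    1 ≤ |∏ q ∈ Finset.range p, (2 * (n : ℝ) + 2 * (q : ℝ) + 3)| := by
  rw [Finset.abs_prod]
  refine Finset.one_le_prod fun q _ ↦ ?_
  have h : (1 : ℤ) ≤ |2 * (n : ℤ) + 2 * (q : ℤ) + 3| := Int.one_le_abs (by omega)
  exact_mod_cast h

theorem one_le_abs_prod_sphY (n p : ℕ) :
    1 ≤ |∏ q ∈ Finset.range p, (2 * (q : ℝ) + 1 - 2 * (n : ℝ))| := by
  rw [Finset.abs_prod]
  refine Finset.one_le_prod fun q _ ↦ ?_
  have h : (1 : ℤ) ≤ |2 * (q : ℤ) + 1 - 2 * (n : ℤ)| := Int.one_le_abs (by omega)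
  exact_mod_cast h

/-- The product `1·3·5⋯(2n-1)` of the leading coefficients of `sphJ` and `sphY`. -/
noncomputable def oddFactorial (n : ℕ) : ℝ := ∏ q ∈ Finset.range n, (2 * (q : ℝ) + 1)

theorem oddFactorial_succ (n : ℕ) : oddFactorial (n + 1) = oddFactorial n * (2 * n + 1) :=
  Finset.prod_range_succ _ _

theorem one_le_oddFactorial (n : ℕ) : 1 ≤ oddFactorial n :=
  Finset.one_le_prod fun q _ ↦ le_add_of_nonneg_left (by positivity)

theorem oddFactorial_pos (n : ℕ) : 0 < oddFactorial n := one_pos.trans_le (one_le_oddFactorial n)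

theorem factorial_le_oddFactorial_succ (n : ℕ) : (n.factorial : ℝ) ≤ oddFactorial (n + 1) := by
  induction n with
  | zero => simpa using one_le_oddFactorial 1
  | succ n ih =>
    rw [oddFactorial_succ, Nat.factorial_succ, mul_comm]
    push_cast
    exact mul_le_mul ih (by linarith [n.cast_nonneg (α := ℝ)]) (by positivity)
      (oddFactorial_pos _).le

theorem abs_sphJ_le (n : ℕ) {x : ℝ} (hx : 0 ≤ x) :
    |sphJ n x| ≤ x ^ n / oddFactorial (n + 1) * Real.exp (x ^ 2 / 2) := by
  have h : 0 ≤ x ^ n / oddFactorial (n + 1) := div_nonneg (by positivity) (oddFactorial_pos _).le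
  rw [sphJ, abs_mul]
  exact mul_le_mul (abs_of_nonneg h).le (abs_besselSeries_le x (one_le_abs_prod_sphJ n))
    (abs_nonneg _) h

theorem abs_sphY_le (n : ℕ) {x : ℝ} (hx : 0 < x) :
    |sphY n x| ≤ oddFactorial n / x ^ (n + 1) * Real.exp (x ^ 2 / 2) := by
  have h : 0 ≤ oddFactorial n / x ^ (n + 1) := div_nonneg (oddFactorial_pos _).le (by positivity)
  rw [sphY, abs_mul, abs_neg]
  exact mul_le_mul (abs_of_nonneg h).le (abs_besselSeries_le x (one_le_abs_prod_sphY n))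
    (abs_nonneg _) h

theorem norm_sphH_le (n : ℕ) {x : ℝ} (hx : 0 < x) :
    ‖sphH n x‖ ≤ (x ^ n / oddFactorial (n + 1) + oddFactorial n / x ^ (n + 1)) *
      Real.exp (x ^ 2 / 2) := by
  rw [sphH, add_mul]
  refine (norm_add_le _ _).trans ?_
  rw [norm_mul, Complex.norm_I, one_mul, Complex.norm_real, Complex.norm_real]
  exact add_le_add (abs_sphJ_le n hx.le) (abs_sphY_le n hx)

theorem measurable_sphJ (n : ℕ) : Measurable (sphJ n) := by
  unfold sphJ
  have := measurable_besselSeries (one_le_abs_prod_sphJ n)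
  fun_prop

theorem measurable_sphY (n : ℕ) : Measurable (sphY n) := by
  unfold sphY
  have := measurable_besselSeries (one_le_abs_prod_sphY n)
  fun_prop

theorem measurable_sphH (n : ℕ) : Measurable (sphH n) := by
  unfold sphH
  have := measurable_sphJ n
  have := measurable_sphY n
  fun_prop

theorem pow_div_oddFactorial_succ_le (n : ℕ) {y M : ℝ} (hy : 0 ≤ y) (hyM : y ≤ M) :
    y ^ (2 * n + 1) / oddFactorial (n + 1) ≤ M * Real.exp (M ^ 2) := by
  have hM : 0 ≤ M := hy.trans hyM
  calc y ^ (2 * n + 1) / oddFactorial (n + 1) ≤ M ^ (2 * n + 1) / n.factorial := by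
        gcongr
        exact factorial_le_oddFactorial_succ n
    _ = M * ((M ^ 2) ^ n / n.factorial) := by rw [pow_succ, pow_mul]; ring
    _ ≤ M * Real.exp (M ^ 2) := by
        gcongr
        exact Real.pow_div_factorial_le_exp _ (by positivity) n

/-- The constant in the bound for `h_n(y) j_n(x)` on `0 ≤ x ≤ M`, `0 < y ≤ M`; it does not
depend on `n`. -/
noncomputable def kernelConst (M : ℝ) : ℝ :=
  Real.exp (M ^ 2 / 2) ^ 2 * (1 + M * Real.exp (M ^ 2))

theorem kernelConst_nonneg {M : ℝ} (hM : 0 ≤ M) : 0 ≤ kernelConst M := by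
  unfold kernelConst
  positivity

theorem norm_sphH_mul_sphJ_le (n : ℕ) {M x y : ℝ} (hx : 0 ≤ x) (hy : 0 < y) (hxM : x ≤ M)
    (hyM : y ≤ M) :
    (2 * n + 1) * ‖sphH n y * (sphJ n x : ℂ)‖ ≤ kernelConst M * (x ^ n / y ^ (n + 1)) := by
  set E := Real.exp (M ^ 2 / 2)
  have hd : 0 < oddFactorial n := oddFactorial_pos n
  have hd' : 0 < oddFactorial (n + 1) := oddFactorial_pos _
  have hE {z : ℝ} (hz : 0 ≤ z) (hzM : z ≤ M) : Real.exp (z ^ 2 / 2) ≤ E :=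
    Real.exp_le_exp.mpr (by gcongr)
  have hJ : ‖(sphJ n x : ℂ)‖ ≤ x ^ n / oddFactorial (n + 1) * E := by
    rw [Complex.norm_real]
    exact (abs_sphJ_le n hx).trans (mul_le_mul_of_nonneg_left (hE hx hxM) (by positivity))
  have hH : ‖sphH n y‖ ≤
      (y ^ n / oddFactorial (n + 1) + oddFactorial n / y ^ (n + 1)) * E :=
    (norm_sphH_le n hy).trans (mul_le_mul_of_nonneg_left (hE hy.le hyM) (by positivity))
  rw [norm_mul]
  calc (2 * n + 1) * (‖sphH n y‖ * ‖(sphJ n x : ℂ)‖)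
      ≤ (2 * n + 1) * ((y ^ n / oddFactorial (n + 1) + oddFactorial n / y ^ (n + 1)) * E *
          (x ^ n / oddFactorial (n + 1) * E)) := by gcongr
    _ = E ^ 2 * (1 + y ^ (2 * n + 1) / oddFactorial (n + 1) / oddFactorial n) *
          (x ^ n / y ^ (n + 1)) := by
        rw [oddFactorial_succ]
        field_simp
        ring
    _ ≤ E ^ 2 * (1 + M * Real.exp (M ^ 2)) * (x ^ n / y ^ (n + 1)) := by
        gcongr
        exact (div_le_self (by positivity) (one_le_oddFactorial n)).trans
          (pow_div_oddFactorial_succ_le n hy.le hyM)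

end Bessel

/-! ### The radial operators -/

section Radial

theorem integral_one_sub_div_pow_le {R b : ℝ} (hR : 0 < R) (hb : b ≤ R) (n : ℕ) :
    ∫ x in (0 : ℝ)..b, (1 - x / R) ^ n ≤ R / (n + 1) := by
  have h_nonneg : 0 ≤ 1 - b / R := sub_nonneg.mpr ((div_le_one hR).mpr hb)
  rw [intervalIntegral.integral_comp_sub_div (fun x ↦ x ^ n) hR.ne', integral_pow, smul_eq_mul,
    zero_div, sub_zero, one_pow, mul_div_assoc', mul_sub, mul_one]
  gcongr
  exact sub_le_self _ (by positivity)

theorem integral_one_sub_abs_div_pow_le {R a : ℝ} (hR : 0 < R) (ha : a ∈ Icc 0 R) (n : ℕ) :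
    ∫ ρ in (0 : ℝ)..R, (1 - |a - ρ| / R) ^ n ≤ 2 * R / (n + 1) := by
  have h_int (b c : ℝ) : IntervalIntegrable (fun ρ ↦ (1 - |a - ρ| / R) ^ n) volume b c :=
    Continuous.intervalIntegrable (by fun_prop) _ _
  have h_left : ∫ ρ in (0 : ℝ)..a, (1 - |a - ρ| / R) ^ n = ∫ x in (0 : ℝ)..a, (1 - x / R) ^ n := by
    rw [intervalIntegral.integral_comp_sub_left (fun x ↦ (1 - |x| / R) ^ n), sub_self, sub_zero]
    refine intervalIntegral.integral_congr fun x hx ↦ ?_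
    rw [uIcc_of_le ha.1] at hx
    simp only [abs_of_nonneg hx.1]
  have h_right : ∫ ρ in a..R, (1 - |a - ρ| / R) ^ n =
      ∫ x in (0 : ℝ)..(R - a), (1 - x / R) ^ n := by
    simp_rw [abs_sub_comm a]
    rw [intervalIntegral.integral_comp_sub_right (fun x ↦ (1 - |x| / R) ^ n), sub_self]
    refine intervalIntegral.integral_congr fun x hx ↦ ?_
    rw [uIcc_of_le (sub_nonneg.mpr ha.2)] at hx
    simp only [abs_of_nonneg hx.1]
  rw [← intervalIntegral.integral_add_adjacent_intervals (h_int 0 a) (h_int a R), h_left, h_right,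
    mul_div_assoc, two_mul]
  exact add_le_add (integral_one_sub_div_pow_le hR ha.2 n)
    (integral_one_sub_div_pow_le hR (sub_le_self _ ha.1) n)

theorem min_div_max_le {R a ρ : ℝ} (ha : a ≤ R) (hρ : ρ ∈ Ioc 0 R) :
    min a ρ / max a ρ ≤ 1 - |a - ρ| / R := by
  have h_max : 0 < max a ρ := lt_max_of_lt_right hρ.1
  have h_eq : min a ρ / max a ρ = 1 - |a - ρ| / max a ρ := by
    rw [← max_sub_min_eq_abs', sub_div, div_self h_max.ne', sub_sub_cancel]
  rw [h_eq]
  gcongr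
  exact max_le ha hρ.2

theorem norm_kernel_le {κ R a ρ : ℝ} (hκ : 0 < κ) (ha : a ∈ Icc 0 R) (hρ : ρ ∈ Ioc 0 R) (n : ℕ) :
    (2 * n + 1) * ‖sphH n (κ * max a ρ) * (sphJ n (κ * min a ρ) : ℂ) * (ρ : ℂ) ^ 2‖ ≤
      kernelConst (κ * R) / κ * R * (1 - |a - ρ| / R) ^ n := by
  have h_max : 0 < max a ρ := lt_max_of_lt_right hρ.1
  have h_max_le : max a ρ ≤ R := max_le ha.2 hρ.2
  have h_min : 0 ≤ min a ρ := le_min ha.1 hρ.1.le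
  have hR : 0 < R := hρ.1.trans_le hρ.2
  have hC := kernelConst_nonneg (mul_pos hκ hR).le
  have h_bessel := norm_sphH_mul_sphJ_le n (M := κ * R) (x := κ * min a ρ) (y := κ * max a ρ)
    (by positivity) (by positivity)
    (mul_le_mul_of_nonneg_left (min_le_max.trans h_max_le) hκ.le)
    (mul_le_mul_of_nonneg_left h_max_le hκ.le)
  have h_sq : ρ ^ 2 / max a ρ ≤ R := by
    rw [div_le_iff₀ h_max, sq]
    exact mul_le_mul hρ.2 (le_max_right _ _) hρ.1.le hR.le
  rw [norm_mul, norm_pow, Complex.norm_real ρ, Real.norm_of_nonneg hρ.1.le, ← mul_assoc]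
  calc _ ≤ kernelConst (κ * R) * ((κ * min a ρ) ^ n / (κ * max a ρ) ^ (n + 1)) * ρ ^ 2 := by
        gcongr
    _ = kernelConst (κ * R) / κ * (ρ ^ 2 / max a ρ) * (min a ρ / max a ρ) ^ n := by
        rw [div_pow, mul_pow, mul_pow, pow_succ, pow_succ]
        field_simp
    _ ≤ kernelConst (κ * R) / κ * R * (1 - |a - ρ| / R) ^ n := by
        gcongr
        exact min_div_max_le ha.2 hρ

/-- The constant in the bound `‖K_n w‖ ≤ radialConst κ R · ‖I_n‖ / (n + 1)`, where `I_n` is the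
angular integral of `w`. -/
noncomputable def radialConst (κ R : ℝ) : ℝ := 2 * κ ^ 2 * R ^ 2 * kernelConst (κ * R)

theorem radialConst_nonneg {κ R : ℝ} (hκ : 0 ≤ κ) (hR : 0 ≤ R) : 0 ≤ radialConst κ R :=
  mul_nonneg (by positivity) (kernelConst_nonneg (mul_nonneg hκ hR))

theorem norm_integral_kernel_mul_le {κ R : ℝ} (hκ : 0 < κ) (hR : 0 < R) {g : ℝ → ℂ} {a D : ℝ}
    (ha : a ∈ Icc 0 R) (hD : ∀ ρ ∈ Icc 0 R, ‖g ρ‖ ≤ D) (n : ℕ) :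
    (2 * n + 1) * ‖∫ ρ in (0 : ℝ)..R,
      sphH n (κ * max a ρ) * (sphJ n (κ * min a ρ) : ℂ) * g ρ * (ρ : ℂ) ^ 2‖ ≤
      kernelConst (κ * R) / κ * R * D * (2 * R / (n + 1)) := by
  have hC := kernelConst_nonneg (mul_pos hκ hR).le
  have hD_nonneg : 0 ≤ D := (norm_nonneg _).trans (hD 0 ⟨le_rfl, hR.le⟩)
  calc _ = ‖∫ ρ in (0 : ℝ)..R, ((2 * n + 1 : ℝ) : ℂ) *
          (sphH n (κ * max a ρ) * (sphJ n (κ * min a ρ) : ℂ) * g ρ * (ρ : ℂ) ^ 2)‖ := by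
        rw [intervalIntegral.integral_const_mul, norm_mul, Complex.norm_real,
          Real.norm_of_nonneg (by positivity)]
    _ ≤ ∫ ρ in (0 : ℝ)..R, kernelConst (κ * R) / κ * R * D * (1 - |a - ρ| / R) ^ n := by
        refine intervalIntegral.norm_integral_le_of_norm_le hR.le
          (Eventually.of_forall fun ρ hρ ↦ ?_)
          (Continuous.intervalIntegrable (by fun_prop) _ _)
        have h_kernel := norm_kernel_le hκ ha hρ n
        rw [norm_mul, Complex.norm_real, Real.norm_of_nonneg (by positivity), mul_right_comm,
          norm_mul _ (g ρ), ← mul_assoc, mul_right_comm _ D]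
        exact mul_le_mul h_kernel (hD ρ ⟨hρ.1.le, hρ.2⟩) (norm_nonneg _)
          ((by positivity : (0 : ℝ) ≤ _).trans h_kernel)
    _ ≤ kernelConst (κ * R) / κ * R * D * (2 * R / (n + 1)) := by
        rw [intervalIntegral.integral_const_mul]
        gcongr
        exact integral_one_sub_abs_div_pow_le hR ha n

theorem norm_opKn_le {κ R : ℝ} (hκ : 0 < κ) (hR : 0 < R) {m w : ℝ → ℝ → ℂ} {n : ℕ} {a D : ℝ}
    (ha : a ∈ Icc 0 R) (hD : ∀ ρ ∈ Icc 0 R, ‖angInt m w n ρ‖ ≤ D) :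
    ‖opKn κ R m n w a‖ ≤ radialConst κ R * (D / (n + 1)) := by
  have h_norm : ‖-(2 * (n : ℂ) + 1) * (κ : ℂ) ^ 3‖ = κ ^ 3 * (2 * n + 1) := by
    rw [norm_mul, norm_neg, norm_pow, Complex.norm_real, Real.norm_of_nonneg hκ.le, mul_comm,
      (by push_cast; rfl : 2 * (n : ℂ) + 1 = ((2 * n + 1 : ℝ) : ℂ)), Complex.norm_real,
      Real.norm_of_nonneg (by positivity)]
  rw [opKn, norm_mul, h_norm, mul_assoc]
  calc _ ≤ κ ^ 3 * (kernelConst (κ * R) / κ * R * D * (2 * R / (n + 1))) :=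
        mul_le_mul_of_nonneg_left (norm_integral_kernel_mul_le hκ hR ha hD n) (by positivity)
    _ = radialConst κ R * (D / (n + 1)) := by
        rw [radialConst]
        field_simp

end Radial

/-! ### Bounded measurable axisymmetric functions -/

section BddMeas

theorem intervalIntegrable_of_norm_le {f : ℝ → ℂ} {a b A : ℝ} (hab : a ≤ b) (hf : Measurable f)
    (h : ∀ t ∈ Icc a b, ‖f t‖ ≤ A) : IntervalIntegrable f volume a b := by
  rw [intervalIntegrable_iff_integrableOn_Icc_of_le hab]
  exact Measure.integrableOn_of_bounded measure_Icc_lt_top.ne hf.aestronglyMeasurable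
    ((ae_restrict_iff' measurableSet_Icc).mpr (Eventually.of_forall h))

variable {R : ℝ} {f g : ℝ → ℝ → ℂ}

theorem norm_le_toReal_supNorm (hf : supNorm R f < ⊤) {ρ t : ℝ} (hρ : ρ ∈ Icc 0 R)
    (ht : t ∈ Icc (-1 : ℝ) 1) : ‖f ρ t‖ ≤ (supNorm R f).toReal := by
  rw [← toReal_enorm]
  refine ENNReal.toReal_mono hf.ne ?_
  exact (le_iSup₂ (f := fun t (_ : t ∈ Icc (-1 : ℝ) 1) ↦ ‖f ρ t‖ₑ) t ht).trans
    (le_iSup₂ (f := fun ρ (_ : ρ ∈ Icc (0 : ℝ) R) ↦ ⨆ t ∈ Icc (-1 : ℝ) 1, ‖f ρ t‖ₑ) ρ hρ)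

theorem supNorm_le_ofReal {c : ℝ} (h : ∀ ρ ∈ Icc 0 R, ∀ t ∈ Icc (-1 : ℝ) 1, ‖f ρ t‖ ≤ c) :
    supNorm R f ≤ ENNReal.ofReal c := by
  refine iSup₂_le fun ρ hρ ↦ iSup₂_le fun t ht ↦ ?_
  rw [← ofReal_norm]
  exact ENNReal.ofReal_le_ofReal (h ρ hρ t ht)

theorem bddMeas_of_norm_le (hf : Measurable (Function.uncurry f)) {c : ℝ}
    (h : ∀ ρ ∈ Icc 0 R, ∀ t ∈ Icc (-1 : ℝ) 1, ‖f ρ t‖ ≤ c) : BddMeas R f :=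
  ⟨hf, (supNorm_le_ofReal h).trans_lt ENNReal.ofReal_lt_top⟩

theorem BddMeas.exists_norm_le (hf : BddMeas R f) :
    ∃ A : ℝ, 0 ≤ A ∧ ∀ ρ ∈ Icc 0 R, ∀ t ∈ Icc (-1 : ℝ) 1, ‖f ρ t‖ ≤ A :=
  ⟨_, ENNReal.toReal_nonneg, fun _ hρ _ ht ↦ norm_le_toReal_supNorm hf.2 hρ ht⟩

theorem BddMeas.add (hf : BddMeas R f) (hg : BddMeas R g) :
    BddMeas R fun ρ t ↦ f ρ t + g ρ t := by
  obtain ⟨A, -, hA⟩ := hf.exists_norm_le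
  obtain ⟨B, -, hB⟩ := hg.exists_norm_le
  exact bddMeas_of_norm_le (hf.1.add hg.1) (c := A + B) fun ρ hρ t ht ↦
    (norm_add_le _ _).trans (add_le_add (hA ρ hρ t ht) (hB ρ hρ t ht))

theorem BddMeas.mul (hf : BddMeas R f) (hg : BddMeas R g) :
    BddMeas R fun ρ t ↦ f ρ t * g ρ t := by
  obtain ⟨A, hA_nonneg, hA⟩ := hf.exists_norm_le
  obtain ⟨B, -, hB⟩ := hg.exists_norm_le
  refine bddMeas_of_norm_le (hf.1.mul hg.1) (c := A * B) fun ρ hρ t ht ↦ ?_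
  rw [norm_mul]
  exact mul_le_mul (hA ρ hρ t ht) (hB ρ hρ t ht) (norm_nonneg _) hA_nonneg

theorem bddMeas_const (c : ℂ) : BddMeas R fun _ _ ↦ c :=
  bddMeas_of_norm_le measurable_const fun _ _ _ _ ↦ le_rfl

theorem BddMeas.sub (hf : BddMeas R f) (hg : BddMeas R g) :
    BddMeas R fun ρ t ↦ f ρ t - g ρ t := by
  simpa only [neg_one_mul, ← sub_eq_add_neg] using hf.add ((bddMeas_const (-1)).mul hg)

theorem BddMeas.sum {ι : Type*} (s : Finset ι) {f : ι → ℝ → ℝ → ℂ}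
    (hf : ∀ i ∈ s, BddMeas R (f i)) : BddMeas R fun ρ t ↦ ∑ i ∈ s, f i ρ t := by
  classical
  induction s using Finset.induction_on with
  | empty => simpa only [Finset.sum_empty] using bddMeas_const 0
  | insert i s hi ih =>
    simp only [Finset.sum_insert hi]
    exact (hf i (Finset.mem_insert_self i s)).add
      (ih fun j hj ↦ hf j (Finset.mem_insert_of_mem hj))

theorem bddMeas_P (n : ℕ) : BddMeas R fun _ t ↦ (P n t : ℂ) :=
  bddMeas_of_norm_le ((continuous_ofReal_P n).comp continuous_snd).measurable
    fun _ _ _ ht ↦ norm_P_le_one n ht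

theorem BddMeas.intervalIntegrable (hf : BddMeas R f) {ρ : ℝ} (hρ : ρ ∈ Icc 0 R) :
    IntervalIntegrable (f ρ) volume (-1) 1 := by
  obtain ⟨A, -, hA⟩ := hf.exists_norm_le
  exact intervalIntegrable_of_norm_le (by norm_num) (hf.1.comp measurable_prodMk_left) (hA ρ hρ)

theorem BddMeas.integral (hf : BddMeas R f) :
    BddMeas R fun ρ _ ↦ ∫ t in (-1 : ℝ)..1, f ρ t := by
  obtain ⟨A, -, hA⟩ := hf.exists_norm_le
  have h_meas : Measurable fun ρ ↦ ∫ t in (-1 : ℝ)..1, f ρ t := by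
    simp_rw [intervalIntegral.integral_of_le (show (-1 : ℝ) ≤ 1 by norm_num)]
    exact (hf.1.stronglyMeasurable.integral_prod_right
      (ν := volume.restrict (Ioc (-1 : ℝ) 1))).measurable
  refine bddMeas_of_norm_le (h_meas.comp measurable_fst) (c := A * |1 - (-1)|) fun ρ hρ _ _ ↦ ?_
  refine intervalIntegral.norm_integral_le_of_norm_le_const fun t ht ↦ ?_
  rw [uIoc_of_le (by norm_num)] at ht
  exact hA ρ hρ t (Ioc_subset_Icc_self ht)

theorem BddMeas.trunc (hf : BddMeas R f) (F : ℕ) : BddMeas R (trunc F f) :=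
  BddMeas.sum _ fun n _ ↦ ((bddMeas_const _).mul (hf.mul (bddMeas_P n)).integral).mul (bddMeas_P n)

variable {m w w' : ℝ → ℝ → ℂ}

theorem BddMeas.angInt (hm : BddMeas R m) (hw : BddMeas R w) (n : ℕ) :
    BddMeas R fun ρ _ ↦ angInt m w n ρ :=
  ((hw.mul hm).mul (bddMeas_P n)).integral

theorem angInt_sub (hm : BddMeas R m) (hw : BddMeas R w) (hw' : BddMeas R w') (n : ℕ) {ρ : ℝ}
    (hρ : ρ ∈ Icc 0 R) :
    angInt m (fun ρ t ↦ w ρ t - w' ρ t) n ρ = angInt m w n ρ - angInt m w' n ρ := by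
  unfold AxiLS.angInt
  rw [← intervalIntegral.integral_sub (((hw.mul hm).mul (bddMeas_P n)).intervalIntegrable hρ)
    (((hw'.mul hm).mul (bddMeas_P n)).intervalIntegrable hρ)]
  simp only [sub_mul]

variable {κ a : ℝ}

theorem intervalIntegrable_kernel_mul (hκ : 0 < κ) (hR : 0 < R) (ha : a ∈ Icc 0 R) (n : ℕ)
    {I : ℝ → ℂ} (hI : BddMeas R fun ρ _ ↦ I ρ) :
    IntervalIntegrable (fun ρ ↦ sphH n (κ * max a ρ) * (sphJ n (κ * min a ρ) : ℂ) * I ρ *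
      (ρ : ℂ) ^ 2) volume 0 R := by
  obtain ⟨A, -, hA⟩ := hI.exists_norm_le
  have h_meas : Measurable fun ρ ↦ sphH n (κ * max a ρ) * (sphJ n (κ * min a ρ) : ℂ) * I ρ *
      (ρ : ℂ) ^ 2 := by
    have hH : Measurable fun ρ ↦ sphH n (κ * max a ρ) := (measurable_sphH n).comp (by fun_prop)
    have hJ : Measurable fun ρ ↦ sphJ n (κ * min a ρ) := (measurable_sphJ n).comp (by fun_prop)
    have hI' : Measurable I := hI.1.comp (measurable_prodMk_right (y := (0 : ℝ)))
    fun_prop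
  have h_bound : IntervalIntegrable (fun ρ ↦ kernelConst (κ * R) / κ * R *
      (1 - |a - ρ| / R) ^ n * A) volume 0 R := Continuous.intervalIntegrable (by fun_prop) _ _
  refine h_bound.mono_fun h_meas.aestronglyMeasurable ?_
  rw [EventuallyLE, ae_restrict_iff' measurableSet_uIoc]
  refine Eventually.of_forall fun ρ hρ ↦ ?_
  rw [uIoc_of_le hR.le] at hρ
  have h_kernel := (le_mul_of_one_le_left (norm_nonneg _)
    (le_add_of_nonneg_left (by positivity))).trans (norm_kernel_le hκ ha hρ n)
  rw [mul_right_comm, norm_mul]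
  exact (mul_le_mul h_kernel (hA ρ (Ioc_subset_Icc_self hρ) 0 (by norm_num)) (norm_nonneg _)
    ((norm_nonneg _).trans h_kernel)).trans (le_abs_self _)

theorem opKn_sub (hκ : 0 < κ) (hR : 0 < R) (hm : BddMeas R m) (hw : BddMeas R w)
    (hw' : BddMeas R w') (n : ℕ) (ha : a ∈ Icc 0 R) :
    opKn κ R m n (fun ρ t ↦ w ρ t - w' ρ t) a = opKn κ R m n w a - opKn κ R m n w' a := by
  unfold opKn
  rw [← mul_sub, ← intervalIntegral.integral_sub
    (intervalIntegrable_kernel_mul hκ hR ha n (hm.angInt hw n))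
    (intervalIntegrable_kernel_mul hκ hR ha n (hm.angInt hw' n))]
  congr 1
  refine intervalIntegral.integral_congr fun ρ hρ ↦ ?_
  rw [uIcc_of_le hR.le] at hρ
  simp only [angInt_sub hm hw hw' n hρ]
  ring

theorem opK_sub (hκ : 0 < κ) (hR : 0 < R) (hm : BddMeas R m) (hw : BddMeas R w)
    (hw' : BddMeas R w') (F : ℕ) (ha : a ∈ Icc 0 R) (t : ℝ) :
    opK κ R m F (fun ρ t ↦ w ρ t - w' ρ t) a t = opK κ R m F w a t - opK κ R m F w' a t := by
  simp only [opK, opKn_sub hκ hR hm hw hw' _ ha, sub_mul, Finset.sum_sub_distrib]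

end BddMeas

/-! ### Power sums and the error rate -/

section PowerSums

theorem sum_Ioc_rpow_le {r : ℝ} (hr : r ≤ 0) (hr' : r ≠ -1) {a b : ℕ} (ha : 0 < a)
    (hab : a ≤ b) :
    ∑ l ∈ Finset.Ioc a b, (l : ℝ) ^ r ≤ ((b : ℝ) ^ (r + 1) - (a : ℝ) ^ (r + 1)) / (r + 1) := by
  have ha' : (0 : ℝ) < a := by exact_mod_cast ha
  have h_anti : AntitoneOn (fun x : ℝ ↦ x ^ r) (Icc (a : ℝ) b) := fun x hx y _ hxy ↦
    Real.rpow_le_rpow_of_nonpos (ha'.trans_le hx.1) hxy hr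
  have h_zero : (0 : ℝ) ∉ uIcc (a : ℝ) b := by
    rw [uIcc_of_le (by exact_mod_cast hab)]
    exact fun h ↦ ha'.not_ge h.1
  rw [← integral_rpow (Or.inr ⟨hr', h_zero⟩), ← Finset.Ico_add_one_add_one_eq_Ioc,
    ← Finset.sum_Ico_add' (fun l : ℕ ↦ (l : ℝ) ^ r)]
  exact h_anti.sum_le_integral_Ico hab

theorem sum_Ioc_rpow_neg_le {q : ℝ} (hq : 1 ≤ q) {F : ℕ} (hF : 0 < F) (N : ℕ) :
    ∑ s ∈ Finset.Ioc F N, (s : ℝ) ^ (-(q + 1)) ≤ (F : ℝ) ^ (-q) := by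
  rcases le_or_gt N F with h | h
  · rw [Finset.Ioc_eq_empty_of_le h, Finset.sum_empty]
    positivity
  calc _ ≤ ((F : ℝ) ^ (-q) - (N : ℝ) ^ (-q)) / q := by
        refine (sum_Ioc_rpow_le (by linarith) (by linarith) hF h.le).trans_eq ?_
        rw [show -(q + 1) + 1 = -q by ring, div_neg, ← neg_div, neg_sub]
    _ ≤ (F : ℝ) ^ (-q) / q := by
        gcongr
        exact sub_le_self _ (by positivity)
    _ ≤ (F : ℝ) ^ (-q) := div_le_self (by positivity) hq

theorem exists_sum_Icc_rpow_le {e : ℝ} (he : -1 < e) :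
    ∃ C : ℝ, ∀ F : ℕ, 0 < F → ∑ l ∈ Finset.Icc 1 F, (l : ℝ) ^ e ≤ C * (F : ℝ) ^ (e + 1) := by
  have he' : 0 < e + 1 := by linarith
  rcases le_total e 0 with h | h
  · refine ⟨1 / (e + 1), fun F hF ↦ ?_⟩
    rw [← Finset.add_sum_Ioc_eq_sum_Icc hF, Nat.cast_one, Real.one_rpow]
    calc _ ≤ 1 / (e + 1) + ((F : ℝ) ^ (e + 1) - 1) / (e + 1) := by
          refine add_le_add ((one_le_div he').mpr (by linarith)) ?_
          simpa only [Nat.cast_one, Real.one_rpow] using sum_Ioc_rpow_le h he.ne' one_pos hF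
      _ = 1 / (e + 1) * (F : ℝ) ^ (e + 1) := by ring
  · refine ⟨1, fun F hF ↦ ?_⟩
    calc ∑ l ∈ Finset.Icc 1 F, (l : ℝ) ^ e ≤ ∑ _l ∈ Finset.Icc 1 F, (F : ℝ) ^ e := by
          refine Finset.sum_le_sum fun l hl ↦ ?_
          have := (Finset.mem_Icc.mp hl).2
          gcongr
      _ = 1 * (F : ℝ) ^ (e + 1) := by
          rw [Finset.sum_const, Nat.card_Icc, nsmul_eq_mul, Real.rpow_add_one (by positivity),
            Nat.add_sub_cancel, one_mul, mul_comm]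

end PowerSums

section Rate

theorem one_le_log_natCast {F : ℕ} (hF : 3 ≤ F) : 1 ≤ Real.log F := by
  have hF' : (3 : ℝ) ≤ F := by exact_mod_cast hF
  rw [Real.le_log_iff_exp_le (by linarith)]
  linarith [Real.exp_one_lt_d9]

/-- The order of the error at truncation degree `F` when the Legendre coefficients of the contrast
decay like `l ^ (-p)` and those of the solution like `s ^ (-(p + 2))`. -/
noncomputable def errorRate (p : ℝ) (F : ℕ) : ℝ :=
  if p = 3 then Real.log F * (F : ℝ) ^ (-7 : ℝ) else (F : ℝ) ^ (-min (2 * p + 1) (p + 4))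

variable {p q : ℝ} {F : ℕ}

theorem errorRate_of_ne (hp : p ≠ 3) (F : ℕ) :
    errorRate p F = (F : ℝ) ^ (-min (2 * p + 1) (p + 4)) :=
  if_neg hp

theorem rpow_le_errorRate (hF : 3 ≤ F) : (F : ℝ) ^ (-(2 * p + 1)) ≤ errorRate p F := by
  unfold errorRate
  split_ifs with hp
  · rw [hp, show 2 * (3 : ℝ) + 1 = 7 by norm_num]
    exact le_mul_of_one_le_left (by positivity) (one_le_log_natCast hF)
  · have hF' : (1 : ℝ) ≤ F := by exact_mod_cast (by omega : 1 ≤ F)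
    gcongr
    exact min_le_left _ _

theorem errorRate_le_rpow (hp : p ≠ 3) (hq : q ≤ min (2 * p + 1) (p + 4)) (hF : 1 ≤ F) :
    errorRate p F ≤ (F : ℝ) ^ (-q) := by
  rw [errorRate_of_ne hp]
  exact Real.rpow_le_rpow_of_exponent_le (by exact_mod_cast hF) (neg_le_neg hq)

theorem errorRate_le_log_mul_rpow (hq : q ≤ min (2 * p + 1) (p + 4)) (hF : 3 ≤ F) :
    errorRate p F ≤ Real.log F * (F : ℝ) ^ (-q) := by
  have h_log := one_le_log_natCast hF
  by_cases hp : p = 3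
  · rw [errorRate, if_pos hp]
    rw [hp, show min (2 * (3 : ℝ) + 1) (3 + 4) = 7 by norm_num] at hq
    have hF' : (1 : ℝ) ≤ F := by exact_mod_cast (by omega : 1 ≤ F)
    gcongr
  · exact (errorRate_le_rpow hp hq (by omega)).trans
      (le_mul_of_one_le_left (by positivity) h_log)

theorem exists_rpow_mul_sum_le_errorRate (p : ℝ) :
    ∃ C : ℝ, ∀ F : ℕ, 3 ≤ F →
      (F : ℝ) ^ (-(p + 4)) * ∑ l ∈ Finset.Icc 1 F, (l : ℝ) ^ (2 - p) ≤ C * errorRate p F := by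
  rcases lt_trichotomy p 3 with hp | rfl | hp
  · obtain ⟨C, hC⟩ := exists_sum_Icc_rpow_le (e := 2 - p) (by linarith)
    refine ⟨C, fun F hF ↦ ?_⟩
    have hF' : (0 : ℝ) < F := by exact_mod_cast (by omega : 0 < F)
    calc _ ≤ (F : ℝ) ^ (-(p + 4)) * (C * (F : ℝ) ^ (2 - p + 1)) := by
          gcongr
          exact hC F (by omega)
      _ = C * (F : ℝ) ^ (-(2 * p + 1)) := by
          rw [mul_left_comm, ← Real.rpow_add hF']
          ring_nf
      _ = C * errorRate p F := by
          rw [errorRate_of_ne hp.ne, min_eq_left (by linarith)]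
  · refine ⟨2, fun F hF ↦ ?_⟩
    have h_harmonic : ∑ l ∈ Finset.Icc 1 F, (l : ℝ) ^ (2 - 3 : ℝ) ≤ 1 + Real.log F := by
      have h := harmonic_le_one_add_log F
      rw [harmonic_eq_sum_Icc] at h
      push_cast at h
      simpa only [show (2 - 3 : ℝ) = -1 by norm_num, Real.rpow_neg_one] using h
    rw [errorRate, if_pos rfl, show -(3 + 4 : ℝ) = -7 by norm_num]
    calc _ ≤ (F : ℝ) ^ (-7 : ℝ) * (2 * Real.log F) := by
          gcongr
          linarith [one_le_log_natCast hF]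
      _ = 2 * (Real.log F * (F : ℝ) ^ (-7 : ℝ)) := by ring
  · have h_summable : Summable fun l : ℕ ↦ (l : ℝ) ^ (2 - p) :=
      Real.summable_nat_rpow.mpr (by linarith)
    refine ⟨∑' l : ℕ, (l : ℝ) ^ (2 - p), fun F _ ↦ ?_⟩
    rw [errorRate_of_ne hp.ne', min_eq_right (by linarith), mul_comm]
    gcongr
    exact h_summable.sum_le_tsum _ fun l _ ↦ by positivity

end Rate

/-! ### Summation of the Legendre tail -/

section TailSums

theorem sum_Icc_rpow_neg_le {p : ℝ} (hp : 0 ≤ p) {F s n : ℕ} (hF : 0 < F) (hn : n ≤ s) :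
    ∑ l ∈ Finset.Icc (s - n) (s + n), (l : ℝ) ^ (-p) ≤
      (2 * n + 1) * (2 ^ p * (F : ℝ) ^ (-p)) +
        ∑ l ∈ Finset.Icc (s - n) (F / 2), (l : ℝ) ^ (-p) := by
  have hF' : (0 : ℝ) < F := by exact_mod_cast hF
  have h_large {l : ℕ} (hl : F / 2 < l) : (l : ℝ) ^ (-p) ≤ 2 ^ p * (F : ℝ) ^ (-p) := by
    have hl' : (F : ℝ) / 2 ≤ l := by
      rw [div_le_iff₀ two_pos]
      exact_mod_cast (by omega : F ≤ l * 2)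
    calc (l : ℝ) ^ (-p) ≤ ((F : ℝ) / 2) ^ (-p) :=
          Real.rpow_le_rpow_of_nonpos (by positivity) hl' (by linarith)
      _ = 2 ^ p * (F : ℝ) ^ (-p) := by
          rw [Real.div_rpow hF'.le two_pos.le, Real.rpow_neg two_pos.le, div_inv_eq_mul, mul_comm]
  have h_split : ∀ l ∈ Finset.Icc (s - n) (s + n), (l : ℝ) ^ (-p) ≤
      2 ^ p * (F : ℝ) ^ (-p) + if l ≤ F / 2 then (l : ℝ) ^ (-p) else 0 := fun l _ ↦ by
    split_ifs with h
    · exact le_add_of_nonneg_left (by positivity)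
    · rw [add_zero]
      exact h_large (not_le.mp h)
  refine (Finset.sum_le_sum h_split).trans ?_
  rw [Finset.sum_add_distrib, Finset.sum_const, Nat.card_Icc, nsmul_eq_mul,
    show s + n + 1 - (s - n) = 2 * n + 1 by omega, ← Finset.sum_filter]
  push_cast
  gcongr
  intro l hl
  simp only [Finset.mem_filter, Finset.mem_Icc] at hl ⊢
  omega

theorem sum_Ioc_sum_Icc_le {f : ℕ → ℝ} (hf : ∀ l, 0 ≤ f l) {F n : ℕ} (hn : n ≤ F) (L N : ℕ) :
    ∑ s ∈ Finset.Ioc F N, ∑ l ∈ Finset.Icc (s - n) L, f l ≤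
      ∑ l ∈ Finset.Ioc (F - n) L, l * f l := by
  calc _ = ∑ l ∈ Finset.Ioc (F - n) L, ∑ _s ∈ Finset.Ioc F (min N (l + n)), f l := by
        refine Finset.sum_comm' fun s l ↦ ?_
        simp only [Finset.mem_Ioc, Finset.mem_Icc]
        omega
    _ ≤ ∑ l ∈ Finset.Ioc (F - n) L, l * f l := by
        refine Finset.sum_le_sum fun l _ ↦ ?_
        rw [Finset.sum_const, Nat.card_Ioc, nsmul_eq_mul]
        gcongr
        · exact hf l
        · omega

theorem sum_range_sum_Ioc_div_le {f : ℕ → ℝ} (hf : ∀ l, 0 ≤ f l) (F : ℕ) :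
    ∑ n ∈ Finset.range (F + 1), (∑ l ∈ Finset.Ioc (F - n) (F / 2), f l) / (n + 1) ≤
      2 / F * ∑ l ∈ Finset.Icc 1 F, l * f l := by
  simp_rw [Finset.sum_div]
  calc _ = ∑ l ∈ Finset.Icc 1 (F / 2), ∑ n ∈ Finset.Ioc (F - l) F, f l / (n + 1 : ℝ) := by
        refine Finset.sum_comm' fun n l ↦ ?_
        simp only [Finset.mem_range, Finset.mem_Ioc, Finset.mem_Icc]
        omega
    _ ≤ ∑ l ∈ Finset.Icc 1 (F / 2), ∑ _n ∈ Finset.Ioc (F - l) F, 2 / F * f l := by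
        refine Finset.sum_le_sum fun l hl ↦ Finset.sum_le_sum fun n hn ↦ ?_
        rw [Finset.mem_Icc] at hl
        rw [Finset.mem_Ioc] at hn
        have hF : (0 : ℝ) < F := by exact_mod_cast (by omega : 0 < F)
        have hn' : (F : ℝ) ≤ 2 * (n + 1) := by exact_mod_cast (by omega : F ≤ 2 * (n + 1))
        rw [div_eq_inv_mul]
        refine mul_le_mul_of_nonneg_right ?_ (hf l)
        rw [inv_eq_one_div, div_le_div_iff₀ (by positivity) hF]
        linarith
    _ = 2 / F * ∑ l ∈ Finset.Icc 1 (F / 2), l * f l := by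
        rw [Finset.mul_sum]
        refine Finset.sum_congr rfl fun l hl ↦ ?_
        rw [Finset.mem_Icc] at hl
        rw [Finset.sum_const, Nat.card_Ioc, nsmul_eq_mul, show F - (F - l) = l by omega]
        ring
    _ ≤ 2 / F * ∑ l ∈ Finset.Icc 1 F, l * f l := by
        gcongr
        · exact fun l _ _ ↦ mul_nonneg l.cast_nonneg (hf l)
        · omega

/-- The majorant, up to a constant factor, of the order `n` angular integral of the Legendre tail
`u - u^F`. The first summand comes from the coefficients `m_l` with `l > F / 2`, the second one
from those with `l ≤ F / 2`. -/
noncomputable def tailMajorant (p : ℝ) (F n : ℕ) : ℝ :=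
  (2 * n + 1) * 2 ^ p * (F : ℝ) ^ (-(2 * p + 2)) +
    (F : ℝ) ^ (-(p + 3)) * ∑ l ∈ Finset.Ioc (F - n) (F / 2), (l : ℝ) ^ (1 - p)

variable {p : ℝ} {F n : ℕ}

theorem sum_tail_le_tailMajorant (hp : 0 ≤ p) (hF : 0 < F) (hn : n ≤ F) (N : ℕ) :
    ∑ s ∈ Finset.Ioc F N, (s : ℝ) ^ (-(p + 3)) *
      ∑ l ∈ Finset.Icc (s - n) (s + n), (l : ℝ) ^ (-p) ≤ tailMajorant p F n := by
  have hF' : (0 : ℝ) < F := by exact_mod_cast hF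
  have h_window : ∀ s ∈ Finset.Ioc F N, (s : ℝ) ^ (-(p + 3)) *
      ∑ l ∈ Finset.Icc (s - n) (s + n), (l : ℝ) ^ (-p) ≤
      (s : ℝ) ^ (-(p + 2 + 1)) * ((2 * n + 1) * (2 ^ p * (F : ℝ) ^ (-p))) +
        (F : ℝ) ^ (-(p + 3)) * ∑ l ∈ Finset.Icc (s - n) (F / 2), (l : ℝ) ^ (-p) := fun s hs ↦ by
    rw [Finset.mem_Ioc] at hs
    have hsF : (s : ℝ) ^ (-(p + 3)) ≤ (F : ℝ) ^ (-(p + 3)) :=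
      Real.rpow_le_rpow_of_nonpos hF' (by exact_mod_cast hs.1.le) (by linarith)
    refine (mul_le_mul_of_nonneg_left (sum_Icc_rpow_neg_le hp hF (by omega))
      (by positivity)).trans ?_
    rw [mul_add, show p + 2 + 1 = p + 3 by ring]
    gcongr
  refine (Finset.sum_le_sum h_window).trans ?_
  rw [Finset.sum_add_distrib, ← Finset.sum_mul, ← Finset.mul_sum, tailMajorant]
  refine add_le_add ?_ ?_
  · calc _ ≤ (F : ℝ) ^ (-(p + 2)) * ((2 * n + 1) * (2 ^ p * (F : ℝ) ^ (-p))) := by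
          gcongr
          exact sum_Ioc_rpow_neg_le (by linarith) hF N
      _ = (2 * n + 1) * 2 ^ p * (F : ℝ) ^ (-(2 * p + 2)) := by
          rw [show -(2 * p + 2) = -(p + 2) + -p by ring, Real.rpow_add hF']
          ring
  · gcongr
    refine (sum_Ioc_sum_Icc_le (fun l ↦ by positivity) hn _ N).trans_eq ?_
    refine Finset.sum_congr rfl fun l hl ↦ ?_
    have hl' : (0 : ℝ) < l := by exact_mod_cast Nat.zero_lt_of_lt (Finset.mem_Ioc.mp hl).1
    rw [sub_eq_add_neg, Real.rpow_add hl', Real.rpow_one]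

theorem sum_tailMajorant_div_le (hF : 0 < F) :
    ∑ n ∈ Finset.range (F + 1), tailMajorant p F n / (n + 1) ≤
      4 * 2 ^ p * (F : ℝ) ^ (-(2 * p + 1)) +
        2 * ((F : ℝ) ^ (-(p + 4)) * ∑ l ∈ Finset.Icc 1 F, (l : ℝ) ^ (2 - p)) := by
  have hF' : (0 : ℝ) < F := by exact_mod_cast hF
  simp_rw [tailMajorant, add_div, mul_div_assoc]
  rw [Finset.sum_add_distrib, ← Finset.mul_sum]
  refine add_le_add ?_ ?_
  · calc _ ≤ ∑ n ∈ Finset.range (F + 1), 2 * 2 ^ p * (F : ℝ) ^ (-(2 * p + 2)) := by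
          refine Finset.sum_le_sum fun n _ ↦ ?_
          rw [mul_div_assoc', div_le_iff₀ (by positivity)]
          have : (0 : ℝ) < 2 ^ p * (F : ℝ) ^ (-(2 * p + 2)) := by positivity
          nlinarith
      _ = (F + 1) * (2 * 2 ^ p * (F : ℝ) ^ (-(2 * p + 2))) := by
          rw [Finset.sum_const, Finset.card_range, nsmul_eq_mul, Nat.cast_add_one]
      _ ≤ (2 * F) * (2 * 2 ^ p * (F : ℝ) ^ (-(2 * p + 2))) := by
          gcongr
          linarith [show (1 : ℝ) ≤ F by exact_mod_cast hF]
      _ = 4 * 2 ^ p * (F : ℝ) ^ (-(2 * p + 1)) := by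
          rw [show -(2 * p + 1) = -(2 * p + 2) + 1 by ring, Real.rpow_add_one hF'.ne']
          ring
  · calc _ ≤ (F : ℝ) ^ (-(p + 3)) * (2 / F * ∑ l ∈ Finset.Icc 1 F, l * (l : ℝ) ^ (1 - p)) := by
          gcongr
          exact sum_range_sum_Ioc_div_le (fun l ↦ by positivity) F
      _ = (F : ℝ) ^ (-(p + 3)) * (2 / F * ∑ l ∈ Finset.Icc 1 F, (l : ℝ) ^ (2 - p)) := by
          congr 2
          refine Finset.sum_congr rfl fun l hl ↦ ?_
          have hl' : (l : ℝ) ≠ 0 := by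
            exact_mod_cast Nat.one_le_iff_ne_zero.mp (Finset.mem_Icc.mp hl).1
          rw [show 2 - p = 1 - p + 1 by ring, Real.rpow_add_one hl', mul_comm]
      _ = _ := by
          rw [show -(p + 4) = -(p + 3) - 1 by ring, Real.rpow_sub_one hF'.ne']
          ring

theorem exists_sum_tailMajorant_div_le_errorRate (p : ℝ) :
    ∃ C : ℝ, ∀ F : ℕ, 3 ≤ F →
      ∑ n ∈ Finset.range (F + 1), tailMajorant p F n / (n + 1) ≤ C * errorRate p F := by
  obtain ⟨C, hC⟩ := exists_rpow_mul_sum_le_errorRate p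
  refine ⟨4 * 2 ^ p + 2 * C, fun F hF ↦ ?_⟩
  calc _ ≤ 4 * 2 ^ p * (F : ℝ) ^ (-(2 * p + 1)) +
        2 * ((F : ℝ) ^ (-(p + 4)) * ∑ l ∈ Finset.Icc 1 F, (l : ℝ) ^ (2 - p)) :=
        sum_tailMajorant_div_le (by omega)
    _ ≤ 4 * 2 ^ p * errorRate p F + 2 * (C * errorRate p F) := by
        gcongr ?_ * ?_ + ?_ * ?_
        · exact rpow_le_errorRate hF
        · exact hC F hF
    _ = (4 * 2 ^ p + 2 * C) * errorRate p F := by ring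

end TailSums

/-! ### The error of the truncated equation -/

section Tail

variable {f g : ℝ → ℂ} {p Cf Cg : ℝ} {F n : ℕ}

theorem norm_integral_mul_sub_sum_le (hf : IntervalIntegrable f volume (-1) 1)
    (hg : IntervalIntegrable g volume (-1) 1) (hp : 0 ≤ p)
    (hCf : ∀ s : ℕ, 1 ≤ s → ‖legendreCoeff f s‖ ≤ Cf * (s : ℝ) ^ (-(p + 2)))
    (hCg : ∀ l : ℕ, 1 ≤ l → ‖legendreCoeff g l‖ ≤ Cg * (l : ℝ) ^ (-p)) (hF : 0 < F)
    (hn : n ≤ F) :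
    ‖(∫ t in (-1 : ℝ)..1, f t * (g t * (P n t : ℂ))) - ∑ s ∈ Finset.range (F + 1),
      legendreCoeff f s * ∫ t in (-1 : ℝ)..1, (P s t : ℂ) * (g t * (P n t : ℂ))‖ ≤
      2 * Cf * Cg * tailMajorant p F n := by
  have hCf_nonneg : 0 ≤ Cf := by simpa using (norm_nonneg _).trans (hCf 1 le_rfl)
  have hCg_nonneg : 0 ≤ Cg := by simpa using (norm_nonneg _).trans (hCg 1 le_rfl)
  have h_summable : Summable fun s ↦ ‖legendreCoeff f s‖ := by
    refine Summable.of_norm_bounded_eventually_nat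
      ((Real.summable_nat_rpow (p := -(p + 2))).mpr (by linarith) |>.mul_left Cf) ?_
    filter_upwards [eventually_ge_atTop 1] with s hs
    rw [norm_norm]
    exact hCf s hs
  have h_term : ∀ s, F < s →
      ‖legendreCoeff f s * ∫ t in (-1 : ℝ)..1, (P s t : ℂ) * (g t * (P n t : ℂ))‖ ≤
      2 * Cf * Cg * ((s : ℝ) ^ (-(p + 3)) *
        ∑ l ∈ Finset.Icc (s - n) (s + n), (l : ℝ) ^ (-p)) := fun s hs ↦ by
    have hs_pos : (0 : ℝ) < s := by exact_mod_cast (by omega : 0 < s)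
    rw [norm_mul]
    refine (mul_le_mul (hCf s (by omega)) (norm_integral_P_mul_mul_P_le hg hCg (by omega))
      (norm_nonneg _) (by positivity)).trans_eq ?_
    rw [← Finset.mul_sum, show -(p + 3) = -(p + 2) - 1 by ring, Real.rpow_sub_one hs_pos.ne']
    ring
  have h_tendsto := (hasSum_integral_mul_of_summable_legendreCoeff hf h_summable
    (hg.mul_continuousOn (continuous_ofReal_P n).continuousOn)).tendsto_sum_nat
  refine le_of_tendsto (h_tendsto.sub_const _).norm ?_
  filter_upwards [eventually_gt_atTop F] with N hN
  obtain ⟨N, rfl⟩ := Nat.exists_eq_add_one_of_ne_zero (Nat.ne_zero_of_lt hN)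
  rw [← Finset.sum_Ico_eq_sub _ (Nat.add_one_le_iff.mpr hN), Finset.Ico_add_one_add_one_eq_Ioc]
  refine (norm_sum_le_of_le _ fun s hs ↦ h_term s (Finset.mem_Ioc.mp hs).1).trans ?_
  rw [← Finset.mul_sum]
  gcongr
  exact sum_tail_le_tailMajorant hp hF hn _

end Tail

section Error

variable {κ R p : ℝ} {m ui u v : ℝ → ℝ → ℂ}

theorem angInt_trunc (hm : BddMeas R m) (u : ℝ → ℝ → ℂ) (n F : ℕ) {ρ : ℝ} (hρ : ρ ∈ Icc 0 R) :
    angInt m (trunc F u) n ρ = ∑ s ∈ Finset.range (F + 1),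
      coeff u s ρ * ∫ t in (-1 : ℝ)..1, (P s t : ℂ) * (m ρ t * (P n t : ℂ)) := by
  simp only [angInt, trunc, ← intervalIntegral.integral_const_mul]
  rw [← intervalIntegral.integral_finsetSum fun s _ ↦
    (((bddMeas_P s).mul (hm.mul (bddMeas_P n))).intervalIntegrable hρ).const_mul _]
  simp only [Finset.sum_mul, mul_assoc]

theorem norm_angInt_sub_trunc_le (hm : BddMeas R m) (hu : BddMeas R u) {ρ Cu Cm : ℝ}
    (hρ : ρ ∈ Icc 0 R) (hp : 0 ≤ p)
    (hCu : ∀ s : ℕ, 1 ≤ s → ‖coeff u s ρ‖ ≤ Cu * (s : ℝ) ^ (-(p + 2)))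
    (hCm : ∀ l : ℕ, 1 ≤ l → ‖coeff m l ρ‖ ≤ Cm * (l : ℝ) ^ (-p))
    {F n : ℕ} (hF : 0 < F) (hn : n ≤ F) :
    ‖angInt m (fun ρ t ↦ u ρ t - trunc F u ρ t) n ρ‖ ≤ 2 * Cu * Cm * tailMajorant p F n := by
  rw [angInt_sub hm hu (hu.trunc F) n hρ, angInt_trunc hm u n F hρ]
  simp only [angInt, mul_assoc (u ρ _)]
  exact norm_integral_mul_sub_sum_le (hu.intervalIntegrable hρ) (hm.intervalIntegrable hρ) hp
    hCu hCm hF hn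

theorem exists_norm_opK_sub_trunc_le (hκ : 0 < κ) (hR : 0 < R) (hm : BddMeas R m)
    (hu : BddMeas R u) (hp : 0 ≤ p) (hm_decay : CoeffDecay R m p)
    (hu_decay : CoeffDecay R u (p + 2)) :
    ∃ C : ℝ, ∀ F : ℕ, 3 ≤ F → ∀ ρ ∈ Icc 0 R, ∀ t ∈ Icc (-1 : ℝ) 1,
      ‖opK κ R m F (fun ρ t ↦ u ρ t - trunc F u ρ t) ρ t‖ ≤ C * errorRate p F := by
  obtain ⟨Cm, hCm⟩ := hm_decay
  obtain ⟨Cu, hCu⟩ := hu_decay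
  obtain ⟨C, hC⟩ := exists_sum_tailMajorant_div_le_errorRate p
  have hCm_nonneg : 0 ≤ Cm := by
    simpa using (norm_nonneg _).trans (hCm 1 le_rfl 0 ⟨le_rfl, hR.le⟩)
  have hCu_nonneg : 0 ≤ Cu := by
    simpa using (norm_nonneg _).trans (hCu 1 le_rfl 0 ⟨le_rfl, hR.le⟩)
  have h_radial := radialConst_nonneg hκ.le hR.le
  refine ⟨radialConst κ R * (2 * Cu * Cm) * C, fun F hF ρ hρ t ht ↦ ?_⟩
  calc _ ≤ ∑ n ∈ Finset.range (F + 1),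
          radialConst κ R * (2 * Cu * Cm * tailMajorant p F n / (n + 1)) := by
        refine norm_sum_le_of_le _ fun n hn ↦ ?_
        rw [norm_mul]
        refine (mul_le_of_le_one_right (norm_nonneg _) (norm_P_le_one n ht)).trans ?_
        exact norm_opKn_le hκ hR hρ fun r hr ↦ norm_angInt_sub_trunc_le hm hu hr hp
          (fun s hs ↦ hCu s hs r hr) (fun l hl ↦ hCm l hl r hr) (by omega)
          (Finset.mem_range_succ_iff.mp hn)
    _ = radialConst κ R * (2 * Cu * Cm) *
          ∑ n ∈ Finset.range (F + 1), tailMajorant p F n / (n + 1) := by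
        simp only [mul_div_assoc, ← Finset.mul_sum, mul_assoc]
    _ ≤ radialConst κ R * (2 * Cu * Cm) * (C * errorRate p F) := by
        gcongr
        exact hC F hF
    _ = radialConst κ R * (2 * Cu * Cm) * C * errorRate p F := by ring

theorem trunc_eq_of_isExactSolution (hu : IsExactSolution κ R m ui u) (F : ℕ) {ρ : ℝ}
    (hρ : ρ ∈ Icc 0 R) (t : ℝ) :
    trunc F u ρ t = trunc F ui ρ t + Complex.I / 2 * opK κ R m F u ρ t := by
  simp only [trunc, opK, hu.2 _ ρ hρ, add_mul, Finset.sum_add_distrib, Finset.mul_sum, mul_assoc]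

theorem opA_trunc_sub (hκ : 0 < κ) (hR : 0 < R) (hm : BddMeas R m)
    (hu : IsExactSolution κ R m ui u) {F : ℕ} (hv : IsTruncatedSolution κ R m ui F v) {ρ t : ℝ}
    (hρ : ρ ∈ Icc 0 R) (ht : t ∈ Icc (-1 : ℝ) 1) :
    opA κ R m F (fun ρ t ↦ trunc F u ρ t - v ρ t) ρ t =
      Complex.I / 2 * opK κ R m F (fun ρ t ↦ u ρ t - trunc F u ρ t) ρ t := by
  rw [opA, opK_sub hκ hR hm (hu.1.trunc F) hv.1 F hρ, opK_sub hκ hR hm hu.1 (hu.1.trunc F) F hρ]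
  linear_combination trunc_eq_of_isExactSolution hu F hρ t - hv.2 ρ hρ t ht

theorem SupNormBigO.mono {e : ℕ → ℝ → ℝ → ℂ} {r r' : ℕ → ℝ} (h : SupNormBigO R e r)
    (h_nonneg : ∀ᶠ F in atTop, 0 ≤ r F) (h_le : ∀ᶠ F in atTop, r F ≤ r' F) :
    SupNormBigO R e r' := by
  obtain ⟨C, hC⟩ := h
  refine ⟨max C 0, ?_⟩
  filter_upwards [hC, h_nonneg, h_le] with F hF hr hrr'
  refine hF.trans (ENNReal.ofReal_le_ofReal ?_)
  exact mul_le_mul (le_max_left _ _) hrr' hr (le_max_right _ _)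

theorem SupNormBigO.rpow_of_errorRate {e : ℕ → ℝ → ℝ → ℂ} {q : ℝ}
    (h : SupNormBigO R e (errorRate p)) (hp : p ≠ 3) (hq : q ≤ min (2 * p + 1) (p + 4)) :
    SupNormBigO R e fun F ↦ (F : ℝ) ^ (-q) := by
  refine h.mono ?_ ((eventually_ge_atTop 1).mono fun F hF ↦ errorRate_le_rpow hp hq hF)
  exact (eventually_ge_atTop 3).mono fun F hF ↦ (by positivity : (0 : ℝ) ≤ _).trans
    (rpow_le_errorRate hF)

theorem SupNormBigO.log_mul_rpow_of_errorRate {e : ℕ → ℝ → ℝ → ℂ} {q : ℝ}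
    (h : SupNormBigO R e (errorRate p)) (hq : q ≤ min (2 * p + 1) (p + 4)) :
    SupNormBigO R e fun F ↦ Real.log F * (F : ℝ) ^ (-q) := by
  refine h.mono ?_ ((eventually_ge_atTop 3).mono fun F hF ↦ errorRate_le_log_mul_rpow hq hF)
  exact (eventually_ge_atTop 3).mono fun F hF ↦ (by positivity : (0 : ℝ) ≤ _).trans
    (rpow_le_errorRate hF)

end Error

end AxiLS

open AxiLS in
theorem mainTheorem1_general {κ R p : ℝ} (hκ : 0 < κ) (hR : 0 < R) (hp : 0 ≤ p)
    {m ui u : ℝ → ℝ → ℂ} {v : ℕ → ℝ → ℝ → ℂ} (hm : BddMeas R m)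
    (hu : IsExactSolution κ R m ui u) {B : ℝ≥0}
    (hB : ∀ F w, BddMeas R w → supNorm R w ≤ B * supNorm R (opA κ R m F w))
    (hv : ∀ F, IsTruncatedSolution κ R m ui F (v F))
    (hm_decay : CoeffDecay R m p) (hu_decay : CoeffDecay R u (p + 2)) :
    SupNormBigO R (fun F ρ t ↦ trunc F u ρ t - v F ρ t) (errorRate p) := by
  obtain ⟨C, hC⟩ := exists_norm_opK_sub_trunc_le hκ hR hm hu.1 hp hm_decay hu_decay
  refine ⟨B * (1 / 2 * C), (eventually_ge_atTop 3).mono fun F hF ↦ ?_⟩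
  have h_residual : supNorm R (opA κ R m F fun ρ t ↦ trunc F u ρ t - v F ρ t) ≤
      ENNReal.ofReal (1 / 2 * C * errorRate p F) := by
    refine supNorm_le_ofReal fun ρ hρ t ht ↦ ?_
    rw [opA_trunc_sub hκ hR hm hu (hv F) hρ ht, norm_mul, norm_div, Complex.norm_I,
      Complex.norm_ofNat, mul_assoc]
    exact mul_le_mul_of_nonneg_left (hC F hF ρ hρ t ht) (by norm_num)
  rw [mul_assoc, ENNReal.ofReal_mul B.coe_nonneg, ENNReal.ofReal_coe_nnreal]
  exact (hB F _ ((hu.1.trunc F).sub (hv F).1)).trans (mul_le_mul_right h_residual _)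

theorem mainTheorem1 (κ R : ℝ) (hκ : 0 < κ) (hR : 0 < R)
    (m ui u : ℝ → ℝ → ℂ) (v : ℕ → ℝ → ℝ → ℂ)
    (hm : AxiLS.BddMeas R m) (hui : AxiLS.BddMeas R ui)
    (hu : AxiLS.IsExactSolution κ R m ui u)
    (B : NNReal) (hB : ∀ F : ℕ, AxiLS.InvBound κ R m F B)
    (hv : ∀ F : ℕ, AxiLS.IsTruncatedSolution κ R m ui F (v F))
    (k : ℕ) (α : ℝ) (hα : 0 < α) (hα1 : k ≤ 1 → α < 1)
    (hmdecay : AxiLS.CoeffDecay R m ((k : ℝ) + α))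
    (hudecay : AxiLS.CoeffDecay R u ((k : ℝ) + 2 + α)) :
    (3 ≤ k → AxiLS.SupNormBigO R (fun F ρ t => AxiLS.trunc F u ρ t - v F ρ t)
      (fun F => (F : ℝ) ^ (-((k : ℝ) + 2.5 + α + min 1.5 ((k : ℝ) - 2 + α))))) ∧
    (k = 2 → AxiLS.SupNormBigO R (fun F ρ t => AxiLS.trunc F u ρ t - v F ρ t)
      (fun F => Real.log (F : ℝ) * (F : ℝ) ^ (-(4.5 + α + min 1 (0.5 + α))))) ∧
    (k = 1 → AxiLS.SupNormBigO R (fun F ρ t => AxiLS.trunc F u ρ t - v F ρ t)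
      (fun F => (F : ℝ) ^ (-(3 + 2 * α)))) ∧
    (k = 0 → AxiLS.SupNormBigO R (fun F ρ t => AxiLS.trunc F u ρ t - v F ρ t)
      (fun F => (F : ℝ) ^ (-(1 + 2 * α)))) := by
  have h := mainTheorem1_general hκ hR (by positivity) hm hu (fun F ↦ (hB F).2) hv hmdecay
    (add_right_comm (k : ℝ) 2 α ▸ hudecay)
  refine ⟨fun hk ↦ ?_, fun hk ↦ ?_, fun hk ↦ ?_, fun hk ↦ ?_⟩
  · have hk' : (3 : ℝ) ≤ k := by exact_mod_cast hk
    refine h.rpow_of_errorRate (by linarith) (le_min ?_ ?_)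
    · linarith [min_le_right (1.5 : ℝ) (k - 2 + α)]
    · linarith [min_le_left (1.5 : ℝ) (k - 2 + α)]
  · subst hk
    refine h.log_mul_rpow_of_errorRate (le_min ?_ ?_)
    · push_cast
      linarith [min_le_right (1 : ℝ) (0.5 + α)]
    · push_cast
      linarith [min_le_left (1 : ℝ) (0.5 + α)]
  all_goals
    subst hk
    have hα' : α < 1 := hα1 (by norm_num)
    refine h.rpow_of_errorRate ?_ (le_min ?_ ?_) <;> push_cast <;> linarith
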